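/- \textbf{Setting.} Let $S=\{1,\gamma_1,\dots,\gamma_{d-1}\}$ be a finite set of positive integers containing $1$. An integer $n$ is called \emph{admissible} if $s<n/2$ for every $s\in S$ (no wrap-around; in particular $n\ge 3$). For admissible $n$ let $\vec C_n^S$ be the digraph with vertex set $\mathbb Z/n$ and arrows $a\to a+s$ ($a\in\mathbb Z/n$, $s\in S$). Let $\mathbb K$ be any field of characteristic $0$. Let $R_m$ be the $\mathbb K$-space of regular $m$-paths on $\mathbb Z/n$ (the span of all sequences $e_{v_0\dots v_m}$ modulo those with $v_{k-1}=v_k$ for some $k$), with $\partial e_{v_0\dots v_m}=\sum_j(-1)^je_{v_0\dots\widehat{v_j}\dots v_m}$. Let $A_m\subset R_m$ be the span of the allowed paths (all $v_{k-1}\to v_k$ arrows), $\Omega_0=A_0$ and $\Omega_m=\{u\in A_m:\partial u\in A_{m-1}\}$ for $m\ge 1$. Put $H_m^{\mathrm{path}}(\vec C_n^S)=H_m(\Omega_*,\partial)$ and $\beta_m(n)=\dim_{\mathbb K}H_m^{\mathrm{path}}(\vec C_n^S)$. Let $\tau$ be the shift $a\mapsto a+1$, and for $\lambda\in\mathbb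 K$ with $\lambda^n=1$ put $\Omega_m^{(\lambda)}=\{\alpha\in\Omega_m:\tau\alpha=\lambda\alpha\}$ and $H_m^{(\lambda)}=H_m(\Omega_*^{(\lambda)},\partial)$. For a word $w=(s_1,\dots,s_m)\in S^m$ let $f_w^{(\lambda)}=\sum_{a\in\mathbb Z/n}\lambda^{-a}e_{a,\,a+s_1,\,\dots,\,a+s_1+\cdots+s_m}$. \emph{Symbol data} for $S$ consist of: \begin{itemize} \item for each $k\ge 0$, finitely many families $(c_{k,i,w}(t))_{w\in S^k}$, $1\le i\le N_k$, in $\mathbb Z[t,t^{-1}]$ such that, for every field $\mathbb K$ of characteristic $0$, every admissible $n$ and every $\lambda\in\mathbb K$ with $\lambda^n=1$, the vectors $b_{k,i}^{(\lambda)}=\sum_w c_{k,i,w}(\lambda)f_w^{(\lambda)}$, $1\le i\le N_k$, form a basis of $\Omega_k^{(\lambda)}$; \item for each $k\ge1$, a symbol matrix $M_k(t)\in\mathbb Z[t,t^{-1}]^{N_{k-1}\times N_k}$ such that $M_k(\lambda)$ is the matrix of $\partial:\Omega_k^{(\lambda)}\to\Omega_{k-1}^{(\lambda)}$ in these bases,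 for all such $\mathbb K,n,\lambda$; \item for each $k\ge1$, a finite family $(\Delta_{k,j}(t))_j$ of $r_k\times r_k$ minors of $M_k(t)$, where $r_k$ is the generic rank of $M_k(t)$ (its rank over the field of fractions), which controls the rank: for every $x\in\mathbb C^\times$, $\operatorname{rank}M_k(x)=r_k$ if and only if $\Delta_{k,j}(x)\neq0$ for some $j$. \end{itemize} The \emph{cyclotomic support set} of such data is $$\mathcal Q_+(S)=\{q\ge2:\ \Phi_q(t)\text{ divides }\Delta_{k,j}(t)\text{ in }\mathbb Z[t,t^{-1}]\text{ for some }k,j\}.$$ \textbf{Theorem.} There exist symbol data for $S$ whose cyclotomic support set $\mathcal Q_+(S)$ is finite. Moreover, for every choice of symbol data, with cyclotomic support set $\mathcal Q_+(S)$, and every field $\mathbb K$ of characteristic $0$: \begin{enumerate} \item If $n$ is admissible, $\lambda\in\mathbb K$, $\lambda^n=1$, $\lambda\ne1$ and $\operatorname{ord}(\lambda)\notin\mathcal Q_+(S)$, then $H_m^{(\lambda)}=0$ for all $m\ge0$. \item The Betti numbers can only change when divisibility of $n$ by some $q\in\mathcal Q_+(S)$ changes: if $n,n'$ are admissible and every $q\in\mathcal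 Q_+(S)$ satisfies $q\mid n\iff q\mid n'$, then $\beta_m(n)=\beta_m(n')$ for all $m\ge0$. In particular, for all primes $p>2\max S$ with $p\notin\mathcal Q_+(S)$, the sequence $(\beta_m(p))_{m\ge0}$ is independent of $p$. \end{enumerate} -/

import Mathlib

open scoped LaurentPolynomial

universe u

noncomputable section

namespace PathHomology

section PathComplex

variable (K : Type*) [Field K] (V : Type*)

/-- `Λ_m(V; K)`: the vector space spanned by the elementary `m`-paths `e_{v_0 … v_m}`. -/
abbrev PathSpace (m : ℕ) : Type _ := (Fin (m + 1) → V) →₀ K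

/-- `∂ e_{v_0 … v_{m+1}} = ∑_j (-1)^j e_{v_0 … v̂_j … v_{m+1}}`. -/
def freeBoundary (m : ℕ) : PathSpace K V (m + 1) →ₗ[K] PathSpace K V m :=
  Finsupp.linearCombination K fun v : Fin (m + 2) → V =>
    ∑ j : Fin (m + 2), (-1 : K) ^ (j : ℕ) • Finsupp.single (fun i => v (j.succAbove i)) (1 : K)

/-- `I_m(V; K)`: the span of the irregular elementary paths, those with two equal consecutive
vertices. -/
def irregular (m : ℕ) : Submodule K (PathSpace K V m) :=
  Submodule.span K
    {x | ∃ v : Fin (m + 1) → V, (∃ k : Fin m, v k.castSucc = v k.succ) ∧ x = Finsupp.single v 1}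

/-- `R_m(V; K) = Λ_m(V; K) / I_m(V; K)`, the space of regular `m`-paths. -/
abbrev RegularSpace (m : ℕ) : Type _ := PathSpace K V m ⧸ irregular K V m

theorem irregular_le_comap_freeBoundary (m : ℕ) :
    irregular K V (m + 1) ≤ (irregular K V m).comap (freeBoundary K V m) := by
  rw [irregular, Submodule.span_le]
  rintro x ⟨v, ⟨k, hk⟩, rfl⟩
  simp only [SetLike.mem_coe, Submodule.mem_comap, freeBoundary,
    Finsupp.linearCombination_single, one_smul]
  have hne : k.castSucc ≠ k.succ := (Fin.castSucc_lt_succ).ne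
  have hface : (fun i => v (k.castSucc.succAbove i)) = fun i => v (k.succ.succAbove i) := by
    funext i
    rcases lt_trichotomy i k with h | h | h
    · rw [Fin.succAbove_of_castSucc_lt _ _ (by simpa using h),
        Fin.succAbove_of_castSucc_lt _ _ (by rw [Fin.lt_def] at *; simp; omega)]
    · subst h
      rw [Fin.succAbove_castSucc_self, Fin.succAbove_succ_self, hk]
    · rw [Fin.succAbove_of_le_castSucc _ _ (by rw [Fin.le_def]; rw [Fin.lt_def] at h; simp; omega),
        Fin.succAbove_of_le_castSucc _ _ (by rw [Fin.le_def]; rw [Fin.lt_def] at h; simp; omega)]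
  rw [← Finset.add_sum_erase _ _ (Finset.mem_univ k.castSucc),
    ← Finset.add_sum_erase _ _ (Finset.mem_erase.2 ⟨hne.symm, Finset.mem_univ k.succ⟩),
    ← add_assoc, hface]
  refine Submodule.add_mem _ ?_ (Submodule.sum_mem _ fun j hj => Submodule.smul_mem _ _ ?_)
  · simp [pow_succ]
  · simp only [Finset.mem_erase, Finset.mem_univ, and_true] at hj
    obtain ⟨hj1, hj2⟩ := hj
    apply Submodule.subset_span
    cases m with
    | zero =>
      exfalso
      have hk0 : k = 0 := Fin.fin_one_eq_zero k
      subst hk0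
      rcases j with ⟨j, hj⟩
      have : j = 0 ∨ j = 1 := by omega
      rcases this with rfl | rfl
      · exact hj2 rfl
      · exact hj1 rfl
    | succ m =>
      rcases lt_or_ge (j : ℕ) (k : ℕ) with h | h
      · refine ⟨_, ⟨⟨k - 1, by omega⟩, ?_⟩, rfl⟩
        have e1 : j.succAbove (Fin.castSucc ⟨(k : ℕ) - 1, by omega⟩) = k.castSucc := by
          rw [Fin.succAbove_of_le_castSucc _ _ (by rw [Fin.le_def]; simp; omega)]
          ext; simp; omega
        have e2 : j.succAbove (Fin.succ ⟨(k : ℕ) - 1, by omega⟩) = k.succ := by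
          rw [Fin.succAbove_of_le_castSucc _ _ (by rw [Fin.le_def]; simp; omega)]
          ext; simp; omega
        simp only [e1, e2, hk]
      · have hjk : (j : ℕ) ≠ k := fun h' => hj2 (by ext; simpa using h')
        have hjk' : (j : ℕ) ≠ k + 1 := fun h' => hj1 (by ext; simpa using h')
        have hjlt := j.isLt
        refine ⟨_, ⟨⟨k, by omega⟩, ?_⟩, rfl⟩
        have e1 : j.succAbove (Fin.castSucc ⟨(k : ℕ), by omega⟩) = k.castSucc := by
          rw [Fin.succAbove_of_castSucc_lt _ _ (by rw [Fin.lt_def]; simp; omega)]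
          ext; simp
        have e2 : j.succAbove (Fin.succ ⟨(k : ℕ), by omega⟩) = k.succ := by
          rw [Fin.succAbove_of_castSucc_lt _ _ (by rw [Fin.lt_def]; simp; omega)]
          ext; simp
        simp only [e1, e2, hk]

/-- The induced boundary operator `∂ : R_{m+1} → R_m`. -/
def boundary (m : ℕ) : RegularSpace K V (m + 1) →ₗ[K] RegularSpace K V m :=
  Submodule.mapQ _ _ (freeBoundary K V m) (irregular_le_comap_freeBoundary K V m)

variable {V} in
/-- The class of the elementary path `e_{v_0 … v_m}` in `R_m(V; K)`. -/
def elementary {m : ℕ} (v : Fin (m + 1) → V) : RegularSpace K V m :=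
  Submodule.Quotient.mk (Finsupp.single v 1)

variable {V}

/-- `A_m(G; K)`: the span of the allowed `m`-paths, those all of whose steps are arrows of `G`. -/
def allowed (G : Digraph V) (m : ℕ) : Submodule K (RegularSpace K V m) :=
  Submodule.span K
    {x | ∃ v : Fin (m + 1) → V, (∀ k : Fin m, G.Adj (v k.castSucc) (v k.succ)) ∧
      x = elementary K v}

/-- `Ω_m(G; K) = {u ∈ A_m : ∂ u ∈ A_{m-1}}`, with `Ω_0 = A_0`. -/
def Omega (G : Digraph V) : (m : ℕ) → Submodule K (RegularSpace K V m)
  | 0 => allowed K G 0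
  | m + 1 => allowed K G (m + 1) ⊓ (allowed K G m).comap (boundary K V m)

variable {K}

/-- The degree `m` cycles of a graded subspace `C` of `R_*` (the boundary is `0` in degree `0`). -/
def cycles (C : (m : ℕ) → Submodule K (RegularSpace K V m)) :
    (m : ℕ) → Submodule K (RegularSpace K V m)
  | 0 => C 0
  | m + 1 => C (m + 1) ⊓ LinearMap.ker (boundary K V m)

/-- The degree `m` boundaries of a graded subspace `C` of `R_*`. -/
def boundaries (C : (m : ℕ) → Submodule K (RegularSpace K V m)) (m : ℕ) :
    Submodule K (RegularSpace K V m) :=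
  (C (m + 1)).map (boundary K V m)

/-- The homology `H_m(C) = (cycles) / (boundaries)` of a `∂`-stable graded subspace `C` of `R_*`. -/
abbrev Homology (C : (m : ℕ) → Submodule K (RegularSpace K V m)) (m : ℕ) : Type _ :=
  cycles C m ⧸ (boundaries C m).submoduleOf (cycles C m)

end PathComplex

section Circulant

/-- The circulant digraph on `ℤ/n` with connection set (the residues of) `S`: the arrows are
`a → a + s` for `s ∈ S`. -/
def circulant (n : ℕ) (S : Finset ℕ) : Digraph (ZMod n) where
  Adj a b := ∃ s ∈ S, b = a + (s : ZMod n)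

/-- `n` is in the no wrap-around range of `S`: every step is `< n/2`. -/
def NoWrap (S : Finset ℕ) (n : ℕ) : Prop := ∀ s ∈ S, 2 * s < n

variable (K : Type*) [Field K]

/-- The shift `τ(a) = a + 1` on the free path spaces. -/
def freeShift (n m : ℕ) : PathSpace K (ZMod n) m →ₗ[K] PathSpace K (ZMod n) m :=
  Finsupp.lmapDomain K K fun v i => v i + 1

theorem irregular_le_comap_freeShift (n m : ℕ) :
    irregular K (ZMod n) m ≤ (irregular K (ZMod n) m).comap (freeShift K n m) := by
  conv_lhs => rw [irregular]
  rw [Submodule.span_le]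
  rintro x ⟨v, ⟨k, hk⟩, rfl⟩
  simp only [SetLike.mem_coe, Submodule.mem_comap, freeShift, Finsupp.lmapDomain_apply,
    Finsupp.mapDomain_single]
  exact Submodule.subset_span ⟨_, ⟨k, by simp [hk]⟩, rfl⟩

/-- The shift `τ` on the regular path spaces. -/
def shift (n m : ℕ) : RegularSpace K (ZMod n) m →ₗ[K] RegularSpace K (ZMod n) m :=
  Submodule.mapQ _ _ (freeShift K n m) (irregular_le_comap_freeShift K n m)

/-- The Betti number `β_m(n) = dim_K H_m^path` of the circulant digraph. -/
def betti (n : ℕ) (S : Finset ℕ) (m : ℕ) : ℕ :=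
  Module.finrank K (Homology (Omega K (circulant n S)) m)

variable {K}

/-- The Fourier block `Ω_m^(ζ) = {α ∈ Ω_m : τ α = ζ α}`. -/
def OmegaMode (n : ℕ) (S : Finset ℕ) (ζ : Kˣ) (m : ℕ) : Submodule K (RegularSpace K (ZMod n) m) :=
  Omega K (circulant n S) m ⊓ Module.End.eigenspace (shift K n m) (ζ : K)

/-- The block homology `H_m^(ζ) = H_m(Ω_*^(ζ), ∂)`. -/
abbrev ModeHomology (n : ℕ) (S : Finset ℕ) (ζ : Kˣ) (m : ℕ) : Type _ :=
  Homology (OmegaMode n S ζ) m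

/-- The vertex sequence `a, a + s_1, a + s_1 + s_2, …` of the path `(a; s_1, …, s_m)`. -/
def wordPath (n : ℕ) {S : Finset ℕ} {m : ℕ} (a : ZMod n) (w : Fin m → S) : Fin (m + 1) → ZMod n :=
  fun i => a + ∑ j : Fin m with j.castSucc < i, ((w j : ℕ) : ZMod n)

/-- The Fourier generator `f_w^(ζ) = ∑_{a ∈ ℤ/n} ζ^{-a} (a; w)` of a step word `w`
(the residues `a` are represented by `0, …, n - 1`; `ζ ^ n = 1` is understood). -/
def fourierGen (n : ℕ) {S : Finset ℕ} (ζ : Kˣ) {m : ℕ} (w : Fin m → S) :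
    RegularSpace K (ZMod n) m :=
  ∑ a ∈ Finset.range n, (((ζ⁻¹ ^ a : Kˣ) : K)) • elementary K (wordPath n (a : ZMod n) w)

/-- The value of an integral Laurent polynomial at a unit. -/
def evalAt (ζ : Kˣ) : ℤ[T;T⁻¹] →+* K := LaurentPolynomial.eval₂ (Int.castRingHom K) ζ

/-- The path `∑_w c_w(ζ) f_w^(ζ)` with Laurent polynomial coefficients `c_w(t)`. -/
def fourierVec (n : ℕ) {S : Finset ℕ} (ζ : Kˣ) {m : ℕ} (c : (Fin m → S) → ℤ[T;T⁻¹]) :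
    RegularSpace K (ZMod n) m :=
  ∑ w : Fin m → S, evalAt ζ (c w) • fourierGen n ζ w

end Circulant

section Symbols

/-- The generic rank of a Laurent polynomial matrix: its rank over the field of fractions. -/
def genericRank {a b : ℕ} (M : Matrix (Fin a) (Fin b) ℤ[T;T⁻¹]) : ℕ :=
  (M.map (algebraMap ℤ[T;T⁻¹] (FractionRing ℤ[T;T⁻¹]))).rank

/-- The minor of `M` on the chosen rows and columns. -/
def minor {a b r : ℕ} (M : Matrix (Fin a) (Fin b) ℤ[T;T⁻¹])
    (p : (Fin r ↪o Fin a) × (Fin r ↪o Fin b)) : ℤ[T;T⁻¹] :=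
  (M.submatrix p.1 p.2).det

/-- A finite family of minors, of size the generic rank, controls the rank of `M(t)`: at each
nonzero complex number the specialized matrix keeps the generic rank exactly when some member of
the family does not vanish there. The family of all such minors is an example. -/
def ControlsRank {a b : ℕ} (M : Matrix (Fin a) (Fin b) ℤ[T;T⁻¹])
    (F : Finset ((Fin (genericRank M) ↪o Fin a) × (Fin (genericRank M) ↪o Fin b))) : Prop :=
  ∀ x : ℂˣ, (M.map (evalAt x)).rank = genericRank M ↔ ∃ p ∈ F, evalAt x (minor M p) ≠ 0

/-- The choices behind the cyclotomic support set of `S`: bases of all Fourier blocks, the symbol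
matrices of the boundary maps in these bases, and families of minors controlling their ranks.
The bases are given by Laurent polynomial coefficients with respect to the Fourier generators,
uniformly in `n` (in the no wrap-around range), in the field and in the mode. -/
structure SymbolData (S : Finset ℕ) where
  /-- the common dimension of the blocks `Ω_k^(ζ)` -/
  dim : ℕ → ℕ
  /-- the coefficients of the basis vectors in terms of the Fourier generators -/
  coeff : (k : ℕ) → Fin (dim k) → (Fin k → S) → ℤ[T;T⁻¹]
  /-- `symbol k` is the symbol matrix `M_{k+1}(t)` of `∂_{k+1} : Ω_{k+1} → Ω_k` -/
  symbol : (k : ℕ) → Matrix (Fin (dim k)) (Fin (dim (k + 1))) ℤ[T;T⁻¹]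
  /-- the chosen minors of `symbol k` -/
  minors : (k : ℕ) → Finset ((Fin (genericRank (symbol k)) ↪o Fin (dim k)) ×
    (Fin (genericRank (symbol k)) ↪o Fin (dim (k + 1))))
  linearIndependent : ∀ (K : Type u) [Field K] [CharZero K] (n : ℕ), NoWrap S n →
    ∀ ζ : Kˣ, ζ ^ n = 1 → ∀ k, LinearIndependent K fun i => fourierVec n ζ (coeff k i)
  span_eq : ∀ (K : Type u) [Field K] [CharZero K] (n : ℕ), NoWrap S n →
    ∀ ζ : Kˣ, ζ ^ n = 1 → ∀ k,
      Submodule.span K (Set.range fun i => fourierVec n ζ (coeff k i)) = OmegaMode n S ζ k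
  boundary_eq : ∀ (K : Type u) [Field K] [CharZero K] (n : ℕ), NoWrap S n →
    ∀ ζ : Kˣ, ζ ^ n = 1 → ∀ k j,
      boundary K (ZMod n) k (fourierVec n ζ (coeff (k + 1) j)) =
        ∑ i, evalAt ζ (symbol k i j) • fourierVec n ζ (coeff k i)
  controls : ∀ k, ControlsRank (symbol k) (minors k)

/-- The cyclotomic support set `Q₊(S)` of the chosen data: all `q ≥ 2` such that the cyclotomic
polynomial `Φ_q(t)` divides at least one of the chosen minors, in some degree. -/
def SymbolData.cyclotomicSupport {S : Finset ℕ} (D : SymbolData.{u} S) : Set ℕ :=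
  {q | 2 ≤ q ∧ ∃ k, ∃ p ∈ D.minors k,
    Polynomial.toLaurent (Polynomial.cyclotomic q ℤ) ∣ minor (D.symbol k) p}

end Symbols

end PathHomology

end

/-! Write τ for the shift. Since 1 ∈ S, every vertex has an arrow a → τ(a), so τ is homotopic to the
identity: the prism operator h, sending e_v to the alternating sum over j of the paths v_0 … v_j
τ(v_j) … τ(v_m), satisfies ∂h + h∂ = τ − 1, commutes with τ and maps Ω_m into Ω_{m+1}
(`homotopy_mem_Omega`).

On the block where τ acts as λ this makes λ − 1 null-homotopic, so every block with λ ≠ 1 is acyclic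
(`subsingleton_modeHomology`). In characteristic 0, averaging over the powers of τ shows that the
block λ = 1 carries the whole homology (`nonempty_modeHomology_one_equiv`). Any symbol data present
that block by the matrices M_k(1), in which n does not occur; hence for admissible n the Betti
numbers do not depend on n (`betti_eq_finrank_coordHomology`).

There remains the existence of symbol data. Among the faces of f_w only the initial one involves λ,
and it is again a word in S. The conditions cutting out Ω_m inside the span of the f_w are therefore
integral, the same for all n and λ, and a rational kernel basis serves all blocks at once
(`fourierMap_mem_Omega_iff`, `OmegaBasis`). The differential becomes a matrix over ℚ[t,t⁻¹], whose
square vanishes because it vanishes at infinitely many roots of unity.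

As ℚ[t,t⁻¹] is a principal ideal domain, each degree has a basis starting with a basis of the
cycles. In such bases the differential has a single nonzero block, injective over ℚ[t,t⁻¹] and, by
acyclicity, surjective at every root of unity λ ≠ 1. The block is thus square, and its determinant
is one minor that controls the rank and vanishes at no primitive q-th root of unity with q ≥ 2.
After clearing denominators this gives symbol data with empty cyclotomic support. -/

noncomputable section

namespace PathHomology

/-! ### Simplicial boundary and prism operator on lists of vertices -/

section Lists

variable (K : Type*) [Field K] {V : Type*}

/-- Prepending a vertex to a list of vertices. -/
def consMap (a : V) : (List V →₀ K) →ₗ[K] (List V →₀ K) :=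
  Finsupp.lmapDomain K K (List.cons a)

@[simp] theorem consMap_single (a : V) (l : List V) (c : K) :
    consMap K a (Finsupp.single l c) = Finsupp.single (a :: l) c := by
  simp [consMap, Finsupp.lmapDomain_apply, Finsupp.mapDomain_single]

/-- The augmented simplicial boundary of a list of vertices. -/
def listFaces : List V → (List V →₀ K)
  | [] => 0
  | a :: l => Finsupp.single l 1 - consMap K a (listFaces l)

/-- The linear extension of `listFaces`. -/
def listBoundary : (List V →₀ K) →ₗ[K] (List V →₀ K) :=
  Finsupp.linearCombination K (listFaces K)

@[simp] theorem listBoundary_single (l : List V) :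
    listBoundary K (Finsupp.single l 1) = listFaces K l := by
  simp [listBoundary]

/-- Consing a vertex is the cone construction, a contraction of the augmented complex. Lists replace
functions on `Fin` here so that all chain identities follow by recursion from this one. -/
theorem listBoundary_consMap (a : V) (x : List V →₀ K) :
    listBoundary K (consMap K a x) = x - consMap K a (listBoundary K x) := by
  suffices h : listBoundary K ∘ₗ consMap K a =
      LinearMap.id - consMap K a ∘ₗ listBoundary K from LinearMap.congr_fun h x
  ext1 l
  ext1
  simp [listFaces]

theorem listBoundary_listFaces (l : List V) : listBoundary K (listFaces K l) = 0 := by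
  induction l with
  | nil => simp [listFaces]
  | cons a l ih => simp [listFaces, listBoundary_consMap, ih]

/-- The map induced by `σ` on linear combinations of lists of vertices. -/
def listMap (σ : V → V) : (List V →₀ K) →ₗ[K] (List V →₀ K) :=
  Finsupp.lmapDomain K K (List.map σ)

@[simp] theorem listMap_single (σ : V → V) (l : List V) (c : K) :
    listMap K σ (Finsupp.single l c) = Finsupp.single (l.map σ) c := by
  simp [listMap, Finsupp.lmapDomain_apply, Finsupp.mapDomain_single]

theorem listMap_consMap (σ : V → V) (a : V) (x : List V →₀ K) :
    listMap K σ (consMap K a x) = consMap K (σ a) (listMap K σ x) := by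
  suffices h : listMap K σ ∘ₗ consMap K a = consMap K (σ a) ∘ₗ listMap K σ from
    LinearMap.congr_fun h x
  ext1 l
  ext1
  simp

theorem listBoundary_listMap (σ : V → V) (x : List V →₀ K) :
    listBoundary K (listMap K σ x) = listMap K σ (listBoundary K x) := by
  suffices h : listBoundary K ∘ₗ listMap K σ = listMap K σ ∘ₗ listBoundary K from
    LinearMap.congr_fun h x
  ext1 l
  ext1
  simp only [LinearMap.comp_apply, Finsupp.lsingle_apply, listMap_single, listBoundary_single]
  induction l with
  | nil => simp [listFaces]
  | cons a l ih => simp [listFaces, ih, listMap_consMap]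

/-- The prism over a list of vertices, connecting it to its image under `σ`. -/
def listPrisms (σ : V → V) : List V → (List V →₀ K)
  | [] => 0
  | a :: l => Finsupp.single (a :: σ a :: l.map σ) 1 - consMap K a (listPrisms σ l)

/-- The linear extension of `listPrisms`. -/
def listHomotopy (σ : V → V) : (List V →₀ K) →ₗ[K] (List V →₀ K) :=
  Finsupp.linearCombination K (listPrisms K σ)

@[simp] theorem listHomotopy_single (σ : V → V) (l : List V) :
    listHomotopy K σ (Finsupp.single l 1) = listPrisms K σ l := by
  simp [listHomotopy]

theorem listHomotopy_consMap (σ : V → V) (a : V) (x : List V →₀ K) :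
    listHomotopy K σ (consMap K a x) =
      consMap K a (consMap K (σ a) (listMap K σ x)) - consMap K a (listHomotopy K σ x) := by
  suffices h : listHomotopy K σ ∘ₗ consMap K a =
      consMap K a ∘ₗ consMap K (σ a) ∘ₗ listMap K σ - consMap K a ∘ₗ listHomotopy K σ from
    LinearMap.congr_fun h x
  ext1 l
  ext1
  simp [listPrisms]

/-- In the inductive step the cone identity is applied to each term: the two copies of a · σ(l)
cancel, and the rest is a times the inductive hypothesis. -/
theorem listBoundary_listPrisms (σ : V → V) (l : List V) :
    listBoundary K (listPrisms K σ l) + listHomotopy K σ (listFaces K l) =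
      Finsupp.single (l.map σ) 1 - Finsupp.single l 1 := by
  induction l with
  | nil => simp [listPrisms, listFaces]
  | cons a l ih =>
    have h := congrArg (listBoundary K) (listMap_single K σ l 1)
    rw [listBoundary_listMap, listBoundary_single, listBoundary_single] at h
    have ih' := congrArg (consMap K a) ih
    simp only [map_add, map_sub, consMap_single] at ih'
    simp only [listPrisms, listFaces, map_sub, listBoundary_single, listBoundary_consMap,
      listHomotopy_single, listHomotopy_consMap, consMap_single, List.map_cons, h] at ih' ⊢
    rw [← eq_sub_iff_add_eq] at ih'
    rw [ih']
    abel

end Lists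

/-! ### Transfer from lists to the free path spaces -/

section Free

variable (K : Type*) [Field K] {V : Type*}

/-- Elementary paths as lists of vertices. -/
def toList (m : ℕ) : ((Fin m → V) →₀ K) →ₗ[K] (List V →₀ K) :=
  Finsupp.lmapDomain K K List.ofFn

@[simp] theorem toList_single {m : ℕ} (v : Fin m → V) (c : K) :
    toList K m (Finsupp.single v c) = Finsupp.single (List.ofFn v) c := by
  simp [toList, Finsupp.lmapDomain_apply, Finsupp.mapDomain_single]

theorem toList_injective (m : ℕ) : Function.Injective (toList K (V := V) m) :=
  Finsupp.mapDomain_injective List.ofFn_injective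

theorem listFaces_ofFn {m : ℕ} (v : Fin (m + 1) → V) :
    listFaces K (List.ofFn v) =
      ∑ j : Fin (m + 1), (-1 : K) ^ (j : ℕ) •
        Finsupp.single (List.ofFn fun i => v (j.succAbove i)) (1 : K) := by
  induction m with
  | zero => simp [listFaces]
  | succ m ih =>
    rw [List.ofFn_succ, listFaces, ih, map_sum, sub_eq_add_neg,
      ← Finset.sum_neg_distrib, Fin.sum_univ_succ (n := m + 1)]
    congr 1
    · simp
    · refine Finset.sum_congr rfl fun j _ => ?_
      rw [map_smul, consMap_single, ← neg_smul]
      congr 1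
      · simp [pow_succ]
      · rw [List.ofFn_succ]
        simp

theorem toList_freeBoundary (m : ℕ) (x : PathSpace K V (m + 1)) :
    toList K _ (freeBoundary K V m x) = listBoundary K (toList K _ x) := by
  suffices h : toList K _ ∘ₗ freeBoundary K V m = listBoundary K ∘ₗ toList K _ from
    LinearMap.congr_fun h x
  ext1 v
  ext1
  simp [freeBoundary, listFaces_ofFn, -List.ofFn_succ]

theorem freeBoundary_freeBoundary (m : ℕ) (x : PathSpace K V (m + 2)) :
    freeBoundary K V m (freeBoundary K V (m + 1) x) = 0 := by
  apply toList_injective K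
  rw [toList_freeBoundary, toList_freeBoundary, map_zero]
  suffices h : listBoundary K ∘ₗ listBoundary K = (0 : (List V →₀ K) →ₗ[K] _) from
    LinearMap.congr_fun h _
  ext1 l
  ext1
  simp [listBoundary_listFaces]

/-- The vertex sequence `v_0, …, v_j, σ v_j, …, σ v_m`. -/
def prism (σ : V → V) {m : ℕ} (v : Fin (m + 1) → V) (j : Fin (m + 1)) : Fin (m + 2) → V :=
  fun i => if i ≤ j.castSucc then v (j.predAbove i) else σ (v (j.predAbove i))

theorem prism_apply_of_le (σ : V → V) {m : ℕ} (v : Fin (m + 1) → V) {i j : Fin (m + 1)}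
    (h : i ≤ j) : prism σ v j i.castSucc = v i := by
  simp [prism, h, Fin.predAbove_castSucc_of_le _ _ h]

theorem prism_apply_of_ge (σ : V → V) {m : ℕ} (v : Fin (m + 1) → V) {i j : Fin (m + 1)}
    (h : j ≤ i) : prism σ v j i.succ = σ (v i) := by
  have h' : ¬ i.succ ≤ j.castSucc := by
    rw [Fin.le_def] at *; simp; omega
  simp [prism, h', Fin.predAbove_succ_of_le _ _ h]

theorem prism_zero (σ : V → V) {m : ℕ} (v : Fin (m + 1) → V) :
    prism σ v 0 = Fin.cons (v 0) (σ ∘ v) := by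
  funext i
  refine Fin.cases ?_ (fun i => ?_) i
  · exact prism_apply_of_le σ v (le_refl 0)
  · exact prism_apply_of_ge σ v (Fin.zero_le i)

theorem prism_succ (σ : V → V) {m : ℕ} (v : Fin (m + 2) → V) (j : Fin (m + 1)) :
    prism σ v j.succ = Fin.cons (v 0) (prism σ (fun i => v i.succ) j) := by
  funext i
  refine Fin.cases ?_ (fun i => ?_) i
  · exact prism_apply_of_le σ v (Fin.zero_le j.succ)
  · rw [Fin.cons_succ]
    rcases le_or_gt i j.castSucc with h | h
    · have hi : i ≠ Fin.last _ := ne_of_lt (lt_of_le_of_lt h (Fin.castSucc_lt_last j))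
      obtain ⟨i, rfl⟩ := Fin.exists_castSucc_eq.2 hi
      rw [prism_apply_of_le _ _ (Fin.castSucc_le_castSucc_iff.1 h), ← Fin.castSucc_succ,
        prism_apply_of_le _ _ (Fin.succ_le_succ_iff.2 (Fin.castSucc_le_castSucc_iff.1 h))]
    · obtain ⟨i, rfl⟩ := Fin.exists_succ_eq.2 (ne_of_gt (lt_of_le_of_lt (Fin.zero_le _) h))
      have h' : j ≤ i := by rw [Fin.lt_def] at h; rw [Fin.le_def]; simp at h; omega
      rw [prism_apply_of_ge _ _ h', prism_apply_of_ge _ _ (Fin.succ_le_succ_iff.2 h')]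

theorem listPrisms_ofFn (σ : V → V) {m : ℕ} (v : Fin (m + 1) → V) :
    listPrisms K σ (List.ofFn v) =
      ∑ j : Fin (m + 1), (-1 : K) ^ (j : ℕ) •
        Finsupp.single (List.ofFn (prism σ v j)) (1 : K) := by
  induction m with
  | zero => simp [listPrisms, prism_zero]
  | succ m ih =>
    rw [List.ofFn_succ, listPrisms, ih, map_sum, sub_eq_add_neg,
      ← Finset.sum_neg_distrib, Fin.sum_univ_succ (n := m + 1)]
    congr 1
    · simp [prism_zero, Function.comp_def]
    · refine Finset.sum_congr rfl fun j _ => ?_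
      rw [map_smul, consMap_single, ← neg_smul, prism_succ]
      congr 1
      · simp [pow_succ]
      · simp

/-- The homotopy `e_v ↦ ∑_j (-1)^j e_{v_0 … v_j σ(v_j) … σ(v_m)}` on the free path spaces. -/
def freeHomotopy (σ : V → V) (m : ℕ) : PathSpace K V m →ₗ[K] PathSpace K V (m + 1) :=
  Finsupp.linearCombination K fun v => ∑ j : Fin (m + 1), (-1 : K) ^ (j : ℕ) •
    Finsupp.single (prism σ v j) (1 : K)

theorem toList_freeHomotopy (σ : V → V) (m : ℕ) (x : PathSpace K V m) :
    toList K _ (freeHomotopy K σ m x) = listHomotopy K σ (toList K _ x) := by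
  suffices h : toList K _ ∘ₗ freeHomotopy K σ m = listHomotopy K σ ∘ₗ toList K _ from
    LinearMap.congr_fun h x
  ext1 v
  ext1
  simp [freeHomotopy, listPrisms_ofFn, -List.ofFn_succ]

/-- The map induced by `σ` on the free path spaces. -/
def freeMap (σ : V → V) (m : ℕ) : PathSpace K V m →ₗ[K] PathSpace K V m :=
  Finsupp.lmapDomain K K fun v i => σ (v i)

theorem toList_freeMap (σ : V → V) (m : ℕ) (x : PathSpace K V m) :
    toList K _ (freeMap K σ m x) = listMap K σ (toList K _ x) := by
  suffices h : toList K _ ∘ₗ freeMap K σ m = listMap K σ ∘ₗ toList K _ from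
    LinearMap.congr_fun h x
  ext1 v
  ext1
  simp [freeMap, Finsupp.lmapDomain_apply, Finsupp.mapDomain_single, Function.comp_def]

theorem listHomotopy_spec (σ : V → V) (x : List V →₀ K) :
    listBoundary K (listHomotopy K σ x) + listHomotopy K σ (listBoundary K x) =
      listMap K σ x - x := by
  suffices h : listBoundary K ∘ₗ listHomotopy K σ + listHomotopy K σ ∘ₗ listBoundary K =
      listMap K σ - LinearMap.id from LinearMap.congr_fun h x
  ext1 l
  ext1
  simp [listBoundary_listPrisms]

theorem freeHomotopy_succ (σ : V → V) (m : ℕ) (x : PathSpace K V (m + 1)) :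
    freeBoundary K V (m + 1) (freeHomotopy K σ (m + 1) x) +
      freeHomotopy K σ m (freeBoundary K V m x) = freeMap K σ (m + 1) x - x := by
  apply toList_injective K
  simp only [map_add, map_sub, toList_freeBoundary, toList_freeHomotopy, toList_freeMap,
    listHomotopy_spec]

theorem freeHomotopy_zero (σ : V → V) (x : PathSpace K V 0) :
    freeBoundary K V 0 (freeHomotopy K σ 0 x) = freeMap K σ 0 x - x := by
  -- The list boundary is augmented: a single vertex is sent to the empty list, whose prism is 0.
  -- This removes the second term of the homotopy formula in degree 0.
  have h0 : ∀ y : PathSpace K V 0, listHomotopy K σ (listBoundary K (toList K _ y)) = 0 := by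
    intro y
    suffices h : listHomotopy K σ ∘ₗ listBoundary K ∘ₗ toList K (V := V) 1 = 0 from
      LinearMap.congr_fun h y
    ext1 v
    ext1
    simp [listFaces, listPrisms]
  apply toList_injective K
  rw [toList_freeBoundary, toList_freeHomotopy, map_sub, toList_freeMap, ← listHomotopy_spec, h0,
    add_zero]

end Free

end PathHomology
end

noncomputable section

namespace PathHomology

/-! ### Passage to regular paths -/

section Regular

variable (K : Type*) [Field K] {V : Type*}

theorem boundary_mk (m : ℕ) (x : PathSpace K V (m + 1)) :
    boundary K V m (Submodule.Quotient.mk x) = Submodule.Quotient.mk (freeBoundary K V m x) :=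
  rfl

theorem boundary_boundary (m : ℕ) (x : RegularSpace K V (m + 2)) :
    boundary K V m (boundary K V (m + 1) x) = 0 := by
  obtain ⟨x, rfl⟩ := Submodule.Quotient.mk_surjective _ x
  rw [boundary_mk, boundary_mk, freeBoundary_freeBoundary, Submodule.Quotient.mk_zero]

theorem elementary_mem_allowed {G : Digraph V} {m : ℕ} {v : Fin (m + 1) → V}
    (h : ∀ k : Fin m, G.Adj (v k.castSucc) (v k.succ)) : elementary K v ∈ allowed K G m :=
  Submodule.subset_span ⟨v, h, rfl⟩

theorem boundary_mem_Omega {G : Digraph V} {m : ℕ} {x : RegularSpace K V (m + 1)}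
    (hx : x ∈ Omega K G (m + 1)) : boundary K V m x ∈ Omega K G m := by
  cases m with
  | zero => exact hx.2
  | succ m =>
    refine ⟨hx.2, ?_⟩
    rw [SetLike.mem_coe, Submodule.mem_comap, boundary_boundary]
    exact zero_mem _

theorem Omega_le_allowed (G : Digraph V) (m : ℕ) : Omega K G m ≤ allowed K G m := by
  cases m with
  | zero => exact le_rfl
  | succ m => exact inf_le_left

/-- A repetition at k survives in each prism path: in the σ-part, one index later, when j ≤ k, and
in the unchanged initial part when j > k. -/
theorem irregular_le_comap_freeHomotopy (σ : V → V) (m : ℕ) :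
    irregular K V m ≤ (irregular K V (m + 1)).comap (freeHomotopy K σ m) := by
  conv_lhs => rw [irregular]
  rw [Submodule.span_le]
  rintro x ⟨v, ⟨k, hk⟩, rfl⟩
  simp only [SetLike.mem_coe, Submodule.mem_comap, freeHomotopy,
    Finsupp.linearCombination_single, one_smul]
  refine Submodule.sum_mem _ fun j _ => Submodule.smul_mem _ _ (Submodule.subset_span ⟨_, ?_, rfl⟩)
  rcases le_or_gt j k.castSucc with h | h
  · refine ⟨k.succ, ?_⟩
    have h' : j ≤ k.succ := h.trans (Fin.castSucc_le_succ k)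
    rw [prism_apply_of_ge σ v h', ← Fin.succ_castSucc, prism_apply_of_ge σ v h, hk]
  · refine ⟨k.castSucc, ?_⟩
    have h' : k.succ ≤ j := by rw [Fin.lt_def] at h; rw [Fin.le_def]; simpa using h
    rw [prism_apply_of_le σ v h.le, Fin.succ_castSucc, prism_apply_of_le σ v h', hk]

end Regular

/-! ### The homotopy from the identity to the shift preserves Ω -/

section Homotopy

variable (K : Type*) [Field K] (n : ℕ)

/-- The homotopy between the identity and the shift on the regular path spaces. -/
def homotopy (m : ℕ) : RegularSpace K (ZMod n) m →ₗ[K] RegularSpace K (ZMod n) (m + 1) :=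
  Submodule.mapQ _ _ (freeHomotopy K (· + 1) m) (irregular_le_comap_freeHomotopy K _ m)

theorem boundary_homotopy_succ (m : ℕ) (x : RegularSpace K (ZMod n) (m + 1)) :
    boundary K _ (m + 1) (homotopy K n (m + 1) x) + homotopy K n m (boundary K _ m x) =
      shift K n (m + 1) x - x := by
  obtain ⟨x, rfl⟩ := Submodule.Quotient.mk_surjective _ x
  exact congrArg Submodule.Quotient.mk (freeHomotopy_succ K (· + 1) m x)

theorem boundary_homotopy_zero (x : RegularSpace K (ZMod n) 0) :
    boundary K _ 0 (homotopy K n 0 x) = shift K n 0 x - x := by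
  obtain ⟨x, rfl⟩ := Submodule.Quotient.mk_surjective _ x
  exact congrArg Submodule.Quotient.mk (freeHomotopy_zero K (· + 1) x)

theorem boundary_shift (m : ℕ) (x : RegularSpace K (ZMod n) (m + 1)) :
    boundary K _ m (shift K n (m + 1) x) = shift K n m (boundary K _ m x) := by
  obtain ⟨x, rfl⟩ := Submodule.Quotient.mk_surjective _ x
  refine congrArg Submodule.Quotient.mk ?_
  apply toList_injective K
  change toList K _ (freeBoundary K _ m (freeMap K (· + 1) _ x)) =
    toList K _ (freeMap K (· + 1) _ (freeBoundary K _ m x))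
  rw [toList_freeBoundary, toList_freeMap, toList_freeMap, toList_freeBoundary,
    listBoundary_listMap]

theorem homotopy_elementary {m : ℕ} (v : Fin (m + 1) → ZMod n) :
    homotopy K n m (elementary K v) =
      ∑ j : Fin (m + 1), (-1 : K) ^ (j : ℕ) • elementary K (prism (· + 1) v j) := by
  have h : freeHomotopy K (· + 1) m (Finsupp.single v 1) =
      ∑ j : Fin (m + 1), (-1 : K) ^ (j : ℕ) • Finsupp.single (prism (· + 1) v j) (1 : K) := by
    simp [freeHomotopy]
  refine (congrArg (Submodule.mkQ (irregular K (ZMod n) (m + 1))) h).trans ?_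
  rw [map_sum]
  rfl

theorem shift_elementary {m : ℕ} (v : Fin (m + 1) → ZMod n) :
    shift K n m (elementary K v) = elementary K fun i => v i + 1 := by
  refine congrArg (Submodule.mkQ (irregular K (ZMod n) m)) ?_
  simp [freeShift, Finsupp.lmapDomain_apply, Finsupp.mapDomain_single]

variable {K n} in
theorem regular_induction {m : ℕ} {W : Type*} [AddCommGroup W] [Module K W]
    {f g : RegularSpace K (ZMod n) m →ₗ[K] W}
    (h : ∀ v, f (elementary K v) = g (elementary K v)) : f = g := by
  apply Submodule.linearMap_qext
  ext1 v
  ext1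
  exact h v

theorem homotopy_shift (m : ℕ) (x : RegularSpace K (ZMod n) m) :
    homotopy K n m (shift K n m x) = shift K n (m + 1) (homotopy K n m x) := by
  suffices h : homotopy K n m ∘ₗ shift K n m = shift K n (m + 1) ∘ₗ homotopy K n m from
    LinearMap.congr_fun h x
  refine regular_induction fun v => ?_
  simp only [LinearMap.comp_apply, shift_elementary, homotopy_elementary, map_sum, map_smul]
  refine Finset.sum_congr rfl fun j _ => ?_
  congr 2
  funext i
  simp only [prism]
  split_ifs <;> rfl

variable (S : Finset ℕ)

theorem shift_mem_allowed {m : ℕ} {x : RegularSpace K (ZMod n) m}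
    (hx : x ∈ allowed K (circulant n S) m) : shift K n m x ∈ allowed K (circulant n S) m := by
  suffices h : allowed K (circulant n S) m ≤ (allowed K (circulant n S) m).comap (shift K n m)
    from h hx
  conv_lhs => rw [allowed]
  rw [Submodule.span_le]
  rintro _ ⟨v, hv, rfl⟩
  rw [SetLike.mem_coe, Submodule.mem_comap, shift_elementary]
  refine elementary_mem_allowed K fun k => ?_
  obtain ⟨s, hs, h⟩ := hv k
  exact ⟨s, hs, by rw [h]; ring⟩

theorem shift_mem_Omega {m : ℕ} {x : RegularSpace K (ZMod n) m}
    (hx : x ∈ Omega K (circulant n S) m) : shift K n m x ∈ Omega K (circulant n S) m := by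
  cases m with
  | zero => exact shift_mem_allowed K n S hx
  | succ m =>
    refine ⟨shift_mem_allowed K n S hx.1, ?_⟩
    rw [SetLike.mem_coe, Submodule.mem_comap, boundary_shift]
    exact shift_mem_allowed K n S hx.2

variable {S} (h1 : 1 ∈ S)
include h1

/-- The steps of a prism path are those of the original path, some of them translated, together with
one new step v_j → v_j + 1; the latter is an arrow because 1 ∈ S. -/
theorem homotopy_mem_allowed {m : ℕ} {x : RegularSpace K (ZMod n) m}
    (hx : x ∈ allowed K (circulant n S) m) :
    homotopy K n m x ∈ allowed K (circulant n S) (m + 1) := by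
  suffices h : allowed K (circulant n S) m ≤
      (allowed K (circulant n S) (m + 1)).comap (homotopy K n m) from h hx
  conv_lhs => rw [allowed]
  rw [Submodule.span_le]
  rintro _ ⟨v, hv, rfl⟩
  rw [SetLike.mem_coe, Submodule.mem_comap, homotopy_elementary]
  refine Submodule.sum_mem _ fun j _ => Submodule.smul_mem _ _ (elementary_mem_allowed K ?_)
  intro k
  rcases lt_trichotomy k j with h | rfl | h
  · obtain ⟨k, rfl⟩ := Fin.exists_castSucc_eq.2 (ne_of_lt (lt_of_lt_of_le h (Fin.le_last j)))
    have h' : k.succ ≤ j := by rw [Fin.lt_def] at h; rw [Fin.le_def]; simpa using h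
    rw [prism_apply_of_le _ v h.le, Fin.succ_castSucc, prism_apply_of_le _ v h']
    exact hv k
  · rw [prism_apply_of_le _ v le_rfl, prism_apply_of_ge _ v le_rfl]
    exact ⟨1, h1, by simp⟩
  · obtain ⟨k, rfl⟩ := Fin.exists_succ_eq.2 (ne_of_gt (lt_of_le_of_lt (Fin.zero_le j) h))
    have h' : j ≤ k.castSucc := by rw [Fin.lt_def] at h; rw [Fin.le_def]; simp at h ⊢; omega
    rw [prism_apply_of_ge _ v h.le, ← Fin.succ_castSucc, prism_apply_of_ge _ v h']
    obtain ⟨s, hs, h⟩ := hv k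
    exact ⟨s, hs, by rw [h]; ring⟩

/-- The homotopy formula rewrites ∂hx as τx − x − h∂x, and each of these terms is allowed when x and
∂x are. -/
theorem homotopy_mem_Omega {m : ℕ} {x : RegularSpace K (ZMod n) m}
    (hx : x ∈ Omega K (circulant n S) m) :
    homotopy K n m x ∈ Omega K (circulant n S) (m + 1) := by
  refine ⟨homotopy_mem_allowed K n h1 (Omega_le_allowed K _ _ hx), ?_⟩
  rw [SetLike.mem_coe, Submodule.mem_comap]
  cases m with
  | zero =>
    rw [boundary_homotopy_zero]
    exact sub_mem (shift_mem_allowed K n S hx) hx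
  | succ m =>
    rw [eq_sub_of_add_eq (boundary_homotopy_succ K n m x)]
    exact sub_mem (sub_mem (shift_mem_allowed K n S hx.1) hx.1)
      (homotopy_mem_allowed K n h1 hx.2)

end Homotopy

/-! ### Acyclicity of the nontrivial modes -/

section Vanishing

variable {K : Type*} [Field K] {n : ℕ}

theorem mem_of_mem_cycles {V : Type*} {C : (m : ℕ) → Submodule K (RegularSpace K V m)} {m : ℕ}
    {x : RegularSpace K V m} (hx : x ∈ cycles C m) : x ∈ C m := by
  cases m with
  | zero => exact hx
  | succ m => exact hx.1

theorem boundary_homotopy_of_mem_cycles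
    {C : (m : ℕ) → Submodule K (RegularSpace K (ZMod n) m)} {m : ℕ}
    {x : RegularSpace K (ZMod n) m} (hx : x ∈ cycles C m) :
    boundary K _ m (homotopy K n m x) = shift K n m x - x := by
  cases m with
  | zero => exact boundary_homotopy_zero K n x
  | succ m =>
    rw [← boundary_homotopy_succ K n m x, LinearMap.mem_ker.1 hx.2, map_zero, add_zero]

theorem mem_OmegaMode {S : Finset ℕ} {ζ : Kˣ} {m : ℕ} {x : RegularSpace K (ZMod n) m} :
    x ∈ OmegaMode n S ζ m ↔ x ∈ Omega K (circulant n S) m ∧ shift K n m x = (ζ : K) • x := by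
  rw [OmegaMode, Submodule.mem_inf, Module.End.mem_eigenspace_iff]

theorem homotopy_mem_OmegaMode {S : Finset ℕ} (h1 : 1 ∈ S) {ζ : Kˣ} {m : ℕ}
    {x : RegularSpace K (ZMod n) m} (hx : x ∈ OmegaMode n S ζ m) :
    homotopy K n m x ∈ OmegaMode n S ζ (m + 1) := by
  rw [mem_OmegaMode] at hx ⊢
  exact ⟨homotopy_mem_Omega K n h1 hx.1, by rw [← homotopy_shift, hx.2, map_smul]⟩

/-- The blocks of the non-trivial modes are acyclic. -/
theorem exists_boundary_eq_of_mem_cycles {S : Finset ℕ} (h1 : 1 ∈ S) {ζ : Kˣ} (hζ : ζ ≠ 1) {m : ℕ}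
    {x : RegularSpace K (ZMod n) m} (hx : x ∈ cycles (OmegaMode n S ζ) m) :
    ∃ y ∈ OmegaMode n S ζ (m + 1), boundary K _ m y = x := by
  have hm := mem_of_mem_cycles hx
  have hζ' : (ζ : K) - 1 ≠ 0 := sub_ne_zero.2 fun h => hζ (Units.ext h)
  -- On a cycle of the ζ-block the homotopy formula reads ∂hx = τx − x = (ζ − 1)x.
  refine ⟨((ζ : K) - 1)⁻¹ • homotopy K n m x,
    Submodule.smul_mem _ _ (homotopy_mem_OmegaMode h1 hm), ?_⟩
  rw [map_smul, boundary_homotopy_of_mem_cycles hx, (mem_OmegaMode.1 hm).2,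
    inv_smul_eq_iff₀ hζ', sub_smul, one_smul]

theorem subsingleton_modeHomology {S : Finset ℕ} (h1 : 1 ∈ S) {ζ : Kˣ} (hζ : ζ ≠ 1) (m : ℕ) :
    Subsingleton (ModeHomology n S ζ m) := by
  rw [Submodule.Quotient.subsingleton_iff, eq_top_iff]
  rintro ⟨x, hx⟩ -
  exact exists_boundary_eq_of_mem_cycles h1 hζ hx

end Vanishing

/-! ### Averaging: the trivial mode carries the homology -/

section Average

variable (K : Type*) [Field K] (n : ℕ)

/-- The average over the powers of the shift. -/
def average (m : ℕ) : RegularSpace K (ZMod n) m →ₗ[K] RegularSpace K (ZMod n) m :=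
  (n : K)⁻¹ • ∑ i ∈ Finset.range n, shift K n m ^ i

theorem average_apply (m : ℕ) (x : RegularSpace K (ZMod n) m) :
    average K n m x = (n : K)⁻¹ • ∑ i ∈ Finset.range n, (shift K n m ^ i) x := by
  simp [average, LinearMap.sum_apply]

theorem shift_pow_elementary {m : ℕ} (v : Fin (m + 1) → ZMod n) (i : ℕ) :
    (shift K n m ^ i) (elementary K v) = elementary K fun k => v k + i := by
  induction i with
  | zero => simp
  | succ i ih =>
    rw [pow_succ', Module.End.mul_apply, ih, shift_elementary]
    congr 1
    funext k
    push_cast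
    ring

theorem shift_pow_card (m : ℕ) : shift K n m ^ n = 1 :=
  regular_induction fun v => by rw [shift_pow_elementary]; simp

theorem shift_average (m : ℕ) (x : RegularSpace K (ZMod n) m) :
    shift K n m (average K n m x) = average K n m x := by
  rw [average_apply, map_smul, map_sum]
  congr 1
  -- The sum over 0 ≤ i ≤ n is split at either end; the split-off terms agree because τⁿ = 1.
  have h := Finset.sum_range_succ' (fun i => (shift K n m ^ i) x) n
  rw [Finset.sum_range_succ, shift_pow_card, pow_zero] at h
  refine Eq.trans ?_ (add_right_cancel h).symm
  exact Finset.sum_congr rfl fun i _ => by rw [pow_succ', Module.End.mul_apply]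

theorem boundary_shift_pow (m i : ℕ) (x : RegularSpace K (ZMod n) (m + 1)) :
    boundary K _ m ((shift K n (m + 1) ^ i) x) = (shift K n m ^ i) (boundary K _ m x) := by
  induction i with
  | zero => simp
  | succ i ih => rw [pow_succ', pow_succ', Module.End.mul_apply, Module.End.mul_apply,
      boundary_shift, ih]

theorem boundary_average (m : ℕ) (x : RegularSpace K (ZMod n) (m + 1)) :
    boundary K _ m (average K n (m + 1) x) = average K n m (boundary K _ m x) := by
  simp only [average_apply, map_smul, map_sum, boundary_shift_pow]

variable {K n} {S : Finset ℕ}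

theorem shift_pow_mem_Omega {m : ℕ} (i : ℕ) {x : RegularSpace K (ZMod n) m}
    (hx : x ∈ Omega K (circulant n S) m) : (shift K n m ^ i) x ∈ Omega K (circulant n S) m := by
  induction i with
  | zero => simpa
  | succ i ih => rw [pow_succ', Module.End.mul_apply]; exact shift_mem_Omega K n S ih

theorem average_mem_OmegaMode {m : ℕ} {x : RegularSpace K (ZMod n) m}
    (hx : x ∈ Omega K (circulant n S) m) : average K n m x ∈ OmegaMode n S 1 m := by
  rw [mem_OmegaMode]
  refine ⟨?_, by rw [shift_average]; simp⟩
  rw [average_apply]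
  exact Submodule.smul_mem _ _ (Submodule.sum_mem _ fun i _ => shift_pow_mem_Omega i hx)

theorem average_eq_self [CharZero K] (hn : n ≠ 0) {m : ℕ} {x : RegularSpace K (ZMod n) m}
    (hx : x ∈ OmegaMode n S 1 m) : average K n m x = x := by
  have h : ∀ i : ℕ, (shift K n m ^ i) x = x := fun i => by
    induction i with
    | zero => simp
    | succ i ih =>
      rw [pow_succ', Module.End.mul_apply, ih, (mem_OmegaMode.1 hx).2, Units.val_one, one_smul]
  rw [average_apply, Finset.sum_congr rfl fun i _ => h i, Finset.sum_const, Finset.card_range,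
    ← Nat.cast_smul_eq_nsmul K, inv_smul_smul₀ (Nat.cast_ne_zero.2 hn)]

theorem average_mem_cycles {m : ℕ} {x : RegularSpace K (ZMod n) m}
    (hx : x ∈ cycles (Omega K (circulant n S)) m) :
    average K n m x ∈ cycles (OmegaMode n S (1 : Kˣ)) m := by
  cases m with
  | zero => exact average_mem_OmegaMode hx
  | succ m =>
    refine ⟨average_mem_OmegaMode hx.1, ?_⟩
    rw [SetLike.mem_coe, LinearMap.mem_ker, boundary_average, LinearMap.mem_ker.1 hx.2, map_zero]

theorem shift_mem_cycles {m : ℕ} {x : RegularSpace K (ZMod n) m}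
    (hx : x ∈ cycles (Omega K (circulant n S)) m) :
    shift K n m x ∈ cycles (Omega K (circulant n S)) m := by
  cases m with
  | zero => exact shift_mem_Omega K n S hx
  | succ m =>
    refine ⟨shift_mem_Omega K n S hx.1, ?_⟩
    rw [SetLike.mem_coe, LinearMap.mem_ker, boundary_shift, LinearMap.mem_ker.1 hx.2, map_zero]

/-- For a cycle x, τ^{i+1}x − τ^i x is the boundary of hτ^i x, so all translates of x are
homologous, and so is their mean. -/
theorem average_sub_mem_boundaries [CharZero K] (h1 : 1 ∈ S) (hn : n ≠ 0) {m : ℕ}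
    {x : RegularSpace K (ZMod n) m} (hx : x ∈ cycles (Omega K (circulant n S)) m) :
    average K n m x - x ∈ boundaries (Omega K (circulant n S)) m := by
  have h : ∀ i : ℕ, (shift K n m ^ i) x ∈ cycles (Omega K (circulant n S)) m ∧
      (shift K n m ^ i) x - x ∈ boundaries (Omega K (circulant n S)) m := fun i => by
    induction i with
    | zero => exact ⟨by simpa, by simp⟩
    | succ i ih =>
      rw [pow_succ', Module.End.mul_apply]
      refine ⟨shift_mem_cycles ih.1, ?_⟩
      rw [← sub_add_sub_cancel _ ((shift K n m ^ i) x)]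
      refine add_mem ?_ ih.2
      rw [← boundary_homotopy_of_mem_cycles ih.1]
      exact Submodule.mem_map_of_mem (homotopy_mem_Omega K n h1 (mem_of_mem_cycles ih.1))
  have h' : average K n m x - x =
      (n : K)⁻¹ • ∑ i ∈ Finset.range n, ((shift K n m ^ i) x - x) := by
    rw [average_apply, Finset.sum_sub_distrib, smul_sub, Finset.sum_const, Finset.card_range,
      ← Nat.cast_smul_eq_nsmul K, inv_smul_smul₀ (Nat.cast_ne_zero.2 hn)]
  rw [h']
  exact Submodule.smul_mem _ _ (Submodule.sum_mem _ fun i _ => (h i).2)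

theorem cycles_mono {V : Type*} {C C' : (m : ℕ) → Submodule K (RegularSpace K V m)}
    (h : ∀ m, C m ≤ C' m) (m : ℕ) : cycles C m ≤ cycles C' m := by
  cases m with
  | zero => exact h 0
  | succ m => exact inf_le_inf_right _ (h _)

/-- All the homology lives in the trivial mode. -/
theorem nonempty_modeHomology_one_equiv [CharZero K] (h1 : 1 ∈ S) (hn : n ≠ 0) (m : ℕ) :
    Nonempty (ModeHomology n S (1 : Kˣ) m ≃ₗ[K] Homology (Omega K (circulant n S)) m) := by
  let φ : cycles (OmegaMode n S (1 : Kˣ)) m →ₗ[K] Homology (Omega K (circulant n S)) m :=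
    Submodule.mkQ _ ∘ₗ Submodule.inclusion (cycles_mono (fun _ => inf_le_left) m)
  have hφ : Function.Surjective φ := by
    intro y
    obtain ⟨⟨x, hx⟩, rfl⟩ := Submodule.Quotient.mk_surjective _ y
    refine ⟨⟨average K n m x, average_mem_cycles hx⟩, ?_⟩
    exact (Submodule.Quotient.eq _).2 (average_sub_mem_boundaries h1 hn hx)
  have hker : LinearMap.ker φ =
      (boundaries (OmegaMode n S (1 : Kˣ)) m).submoduleOf (cycles (OmegaMode n S (1 : Kˣ)) m) := by
    ext ⟨x, hx⟩
    rw [LinearMap.mem_ker]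
    refine (Submodule.Quotient.mk_eq_zero _).trans ⟨?_, ?_⟩
    -- A chain bounding x in the full complex is averaged into the trivial mode; its boundary is
    -- still x, which the average fixes.
    · rintro ⟨y, hy, hyx⟩
      refine ⟨average K n (m + 1) y, average_mem_OmegaMode hy, ?_⟩
      rw [boundary_average, hyx]
      exact average_eq_self hn (mem_of_mem_cycles hx)
    · rintro ⟨y, hy, hyx⟩
      exact ⟨y, hy.1, hyx⟩
  exact ⟨(Submodule.quotEquivOfEq _ _ hker.symm).trans (φ.quotKerEquivOfSurjective hφ)⟩

end Average

/-! ### Homology in coordinates -/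

section Coordinates

variable {K : Type*} [Field K] {dim : ℕ → ℕ}

/-- The cycles of the complex of coordinate spaces with the boundary maps `d`. -/
def coordCycles (d : (k : ℕ) → Matrix (Fin (dim k)) (Fin (dim (k + 1))) K) :
    (m : ℕ) → Submodule K (Fin (dim m) → K)
  | 0 => ⊤
  | m + 1 => LinearMap.ker (d m).mulVecLin

/-- The homology of the complex of coordinate spaces with the boundary maps `d`. -/
abbrev CoordHomology (d : (k : ℕ) → Matrix (Fin (dim k)) (Fin (dim (k + 1))) K) (m : ℕ) : Type _ :=
  coordCycles d m ⧸ (LinearMap.range (d m).mulVecLin).submoduleOf (coordCycles d m)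

variable {V : Type*} {C : (m : ℕ) → Submodule K (RegularSpace K V m)}
  {d : (k : ℕ) → Matrix (Fin (dim k)) (Fin (dim (k + 1))) K}

/-- The homology of a subcomplex can be computed in coordinates. -/
theorem nonempty_coordHomology_equiv (θ : (k : ℕ) → (Fin (dim k) → K) →ₗ[K] RegularSpace K V k)
    (hθ : ∀ k, Function.Injective (θ k)) (hC : ∀ k, LinearMap.range (θ k) = C k)
    (hd : ∀ k x, boundary K V k (θ (k + 1) x) = θ k ((d k).mulVec x)) (m : ℕ) :
    Nonempty (CoordHomology d m ≃ₗ[K] Homology C m) := by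
  have hcyc : ∀ x, x ∈ coordCycles d m ↔ θ m x ∈ cycles C m := by
    intro x
    cases m with
    | zero => simp [coordCycles, cycles, ← hC]
    | succ m =>
      have h1 : θ (m + 1) x ∈ C (m + 1) := hC (m + 1) ▸ LinearMap.mem_range_self _ x
      simp only [coordCycles, cycles, Submodule.mem_inf, h1, true_and, LinearMap.mem_ker, hd,
        Matrix.mulVecLin_apply]
      rw [map_eq_zero_iff _ (hθ m)]
  let φ : coordCycles d m →ₗ[K] Homology C m :=
    Submodule.mkQ _ ∘ₗ (θ m).restrict fun x hx => (hcyc x).1 hx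
  have hφ : Function.Surjective φ := by
    intro y
    obtain ⟨⟨y, hy⟩, rfl⟩ := Submodule.Quotient.mk_surjective _ y
    obtain ⟨x, rfl⟩ : y ∈ LinearMap.range (θ m) := hC m ▸ mem_of_mem_cycles hy
    exact ⟨⟨x, (hcyc x).2 hy⟩, rfl⟩
  have hker : LinearMap.ker φ =
      (LinearMap.range (d m).mulVecLin).submoduleOf (coordCycles d m) := by
    ext ⟨x, hx⟩
    rw [LinearMap.mem_ker]
    refine (Submodule.Quotient.mk_eq_zero _).trans ⟨?_, ?_⟩
    · rintro ⟨y, hy, hyx⟩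
      obtain ⟨y, rfl⟩ : y ∈ LinearMap.range (θ (m + 1)) := hC (m + 1) ▸ hy
      rw [hd] at hyx
      exact ⟨y, hθ m hyx⟩
    · rintro ⟨y, hyx⟩
      refine ⟨θ (m + 1) y, hC (m + 1) ▸ LinearMap.mem_range_self _ y, ?_⟩
      rw [hd]
      exact congrArg (θ m) hyx
  exact ⟨(Submodule.quotEquivOfEq _ _ hker.symm).trans (φ.quotKerEquivOfSurjective hφ)⟩

end Coordinates

/-! ### Betti numbers from the symbol at t = 1 -/

section Betti

variable {S : Finset ℕ} (D : SymbolData.{u} S) {K : Type u} [Field K] [CharZero K] {n : ℕ}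

theorem nonempty_symbolHomology_equiv (hn : NoWrap S n) {ζ : Kˣ} (hζ : ζ ^ n = 1) (m : ℕ) :
    Nonempty (CoordHomology (fun k => (D.symbol k).map (evalAt ζ)) m ≃ₗ[K]
      ModeHomology n S ζ m) := by
  refine nonempty_coordHomology_equiv
    (fun k => Fintype.linearCombination K fun i => fourierVec n ζ (D.coeff k i)) (fun k => ?_)
    (fun k => ?_) (fun k x => ?_) m
  · exact linearIndependent_iff_injective_fintypeLinearCombination.1
      (D.linearIndependent K n hn ζ hζ k)
  · rw [Fintype.range_linearCombination, D.span_eq K n hn ζ hζ k]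
  · simp only [Fintype.linearCombination_apply, map_sum, map_smul, D.boundary_eq K n hn ζ hζ,
      Finset.smul_sum, smul_smul]
    rw [Finset.sum_comm]
    refine Finset.sum_congr rfl fun i _ => ?_
    rw [← Finset.sum_smul]
    congr 1
    simp only [Matrix.mulVec, dotProduct, Matrix.map_apply, mul_comm]

/-- The right-hand side does not contain n; this is the source of the comparison of Betti numbers.
-/
theorem betti_eq_finrank_coordHomology (h1 : 1 ∈ S) (hn : NoWrap S n) (m : ℕ) :
    betti K n S m =
      Module.finrank K (CoordHomology (fun k => (D.symbol k).map (evalAt (1 : Kˣ))) m) := by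
  have hn0 : n ≠ 0 := by
    have := hn 1 h1
    omega
  obtain ⟨e⟩ := nonempty_modeHomology_one_equiv (K := K) h1 hn0 m
  obtain ⟨e'⟩ := nonempty_symbolHomology_equiv D hn (one_pow n : (1 : Kˣ) ^ n = 1) m
  exact (e'.trans e).finrank_eq.symm

end Betti

end PathHomology
end

noncomputable section

namespace PathHomology

/-! ### Coefficient functionals on regular paths -/

section Coord

variable (K : Type*) [Field K] {V : Type*}

open Classical in
/-- The coefficient of a regular elementary path `e_v` (zero if `v` is irregular). -/
def coord {m : ℕ} (v : Fin (m + 1) → V) : RegularSpace K V m →ₗ[K] K :=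
  Submodule.liftQ _ (if ∃ k : Fin m, v k.castSucc = v k.succ then 0 else Finsupp.lapply v) <| by
    rw [irregular, Submodule.span_le]
    rintro _ ⟨w, hw, rfl⟩
    rw [SetLike.mem_coe, LinearMap.mem_ker]
    split_ifs with h
    · rfl
    · rw [Finsupp.lapply_apply, Finsupp.single_apply, if_neg]
      rintro rfl
      exact h hw

variable {K}

theorem coord_mk {m : ℕ} {v : Fin (m + 1) → V} (hv : ∀ k : Fin m, v k.castSucc ≠ v k.succ)
    (x : PathSpace K V m) : coord K v (Submodule.Quotient.mk x) = x v := by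
  have h : ¬ ∃ k : Fin m, v k.castSucc = v k.succ := by simpa using hv
  refine (Submodule.liftQ_apply _ _ _).trans ?_
  rw [if_neg h, Finsupp.lapply_apply]

theorem coord_elementary {m : ℕ} {v : Fin (m + 1) → V}
    (hv : ∀ k : Fin m, v k.castSucc ≠ v k.succ) (w : Fin (m + 1) → V) [Decidable (w = v)] :
    coord K v (elementary K w) = if w = v then 1 else 0 := by
  classical
  rw [elementary, coord_mk hv, Finsupp.single_apply]

theorem eq_zero_of_coord_eq_zero {m : ℕ} (x : RegularSpace K V m)
    (h : ∀ v, (∀ k : Fin m, v k.castSucc ≠ v k.succ) → coord K v x = 0) : x = 0 := by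
  obtain ⟨x, rfl⟩ := Submodule.Quotient.mk_surjective _ x
  rw [Submodule.Quotient.mk_eq_zero, ← Finsupp.sum_single x]
  refine Submodule.sum_mem _ fun v _ => ?_
  by_cases hv : ∃ k : Fin m, v k.castSucc = v k.succ
  · rw [← mul_one (x v), ← smul_eq_mul, ← Finsupp.smul_single]
    exact Submodule.smul_mem _ _ (Submodule.subset_span ⟨v, hv, rfl⟩)
  · push Not at hv
    rw [← coord_mk hv, h v hv, Finsupp.single_zero]
    exact zero_mem _

theorem coord_eq_zero_of_mem_allowed {G : Digraph V} {m : ℕ} {v : Fin (m + 1) → V}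
    (hv : ∀ k : Fin m, v k.castSucc ≠ v k.succ)
    (hG : ¬ ∀ k : Fin m, G.Adj (v k.castSucc) (v k.succ)) {x : RegularSpace K V m}
    (hx : x ∈ allowed K G m) : coord K v x = 0 := by
  suffices h : allowed K G m ≤ LinearMap.ker (coord K v) from h hx
  rw [allowed, Submodule.span_le]
  rintro _ ⟨w, hw, rfl⟩
  classical
  rw [SetLike.mem_coe, LinearMap.mem_ker, coord_elementary hv, if_neg]
  rintro rfl
  exact hG hw

theorem boundary_elementary {m : ℕ} (v : Fin (m + 2) → V) :
    boundary K V m (elementary K v) =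
      ∑ j : Fin (m + 2), (-1 : K) ^ (j : ℕ) • elementary K (fun i => v (j.succAbove i)) := by
  have h : freeBoundary K V m (Finsupp.single v 1) =
      ∑ j : Fin (m + 2), (-1 : K) ^ (j : ℕ) •
        Finsupp.single (fun i => v (j.succAbove i)) (1 : K) := by
    simp [freeBoundary]
  refine (congrArg (Submodule.mkQ (irregular K V m)) h).trans ?_
  rw [map_sum]
  rfl

end Coord

/-! ### Step words, Fourier generators and their faces -/

section Words

variable (n : ℕ) {m : ℕ}

/-- The vertex sequence starting at `a` with the successive steps `x`. -/
def stepPath (a : ZMod n) (x : Fin m → ℕ) : Fin (m + 1) → ZMod n :=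
  fun i => a + Fin.partialSum (fun j => (x j : ZMod n)) i

@[simp] theorem stepPath_zero (a : ZMod n) (x : Fin m → ℕ) : stepPath n a x 0 = a := by
  simp [stepPath]

theorem stepPath_succ (a : ZMod n) (x : Fin m → ℕ) (j : Fin m) :
    stepPath n a x j.succ = stepPath n a x j.castSucc + x j := by
  simp [stepPath, Fin.partialSum_succ, add_assoc]

theorem eq_stepPath {v : Fin (m + 1) → ZMod n} {x : Fin m → ℕ}
    (h : ∀ j : Fin m, v j.succ = v j.castSucc + x j) : v = stepPath n (v 0) x := by
  funext i
  induction i using Fin.induction with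
  | zero => simp
  | succ i ih => rw [h, stepPath_succ, ih]

theorem stepPath_add (a b : ZMod n) (x : Fin m → ℕ) (i : Fin (m + 1)) :
    stepPath n a x i + b = stepPath n (a + b) x i := by
  simp only [stepPath]
  ring

theorem stepPath_tail (a : ZMod n) (x : Fin (m + 1) → ℕ) :
    (fun i => stepPath n a x (Fin.succAbove 0 i)) = stepPath n (a + x 0) (Fin.tail x) := by
  funext i
  rw [Fin.zero_succAbove, stepPath, Fin.partialSum_succ', ← add_assoc]
  rfl

/-- Deleting vertex j + 1 merges the steps j and j + 1. For the last j there is nothing to merge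
with, and `Fin.contractNth` just drops the last step, so the final face is included. -/
theorem stepPath_contractNth (a : ZMod n) (x : Fin (m + 1) → ℕ) (j : Fin (m + 1)) :
    (fun i => stepPath n a x (j.succ.succAbove i)) =
      stepPath n a (Fin.contractNth j (· + ·) x) := by
  funext i
  have h : (fun k => ((Fin.contractNth j (· + ·) x k : ℕ) : ZMod n)) =
      Fin.contractNth j (· + ·) fun k => (x k : ZMod n) := by
    funext k
    simp only [Fin.contractNth]
    split_ifs <;> simp
  rw [stepPath, stepPath, h, Fin.partialSum_contractNth]
  rfl

theorem wordPath_eq_stepPath {S : Finset ℕ} (a : ZMod n) (w : Fin m → S) :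
    wordPath n a w = stepPath n a fun i => w i := by
  have h0 : wordPath n a w 0 = a := by simp [wordPath]
  conv_rhs => rw [← h0]
  refine eq_stepPath n fun j => ?_
  have h : (Finset.univ.filter fun i : Fin m => i.castSucc < j.succ) =
      insert j (Finset.univ.filter fun i : Fin m => i.castSucc < j.castSucc) := by
    ext i
    simp only [Finset.mem_filter, Finset.mem_univ, true_and, Finset.mem_insert, Fin.lt_def,
      Fin.ext_iff, Fin.val_castSucc, Fin.val_succ]
    omega
  rw [wordPath, wordPath, h, Finset.sum_insert (by simp)]
  ring

theorem sum_range_shift {M : Type*} [AddCommMonoid M] {n : ℕ} {f : ℕ → M}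
    (hf : ∀ a, f (a + n) = f a) (s : ℕ) :
    ∑ a ∈ Finset.range n, f (a + s) = ∑ a ∈ Finset.range n, f a := by
  induction s with
  | zero => rfl
  | succ s ih =>
    rw [← ih]
    have h1 := Finset.sum_range_succ (fun a => f (a + s)) n
    rw [Finset.sum_range_succ', zero_add, add_comm n s, hf] at h1
    cases n with
    | zero => simp
    | succ n =>
      rw [Finset.sum_range_succ, Finset.sum_range_succ' (fun a => f (a + s))]
      congr 1
      · exact Finset.sum_congr rfl fun a _ => by congr 1; ring
      · rw [← hf (0 + s)]
        congr 1
        ring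

variable {K : Type*} [Field K] (ζ : Kˣ)

/-- The Fourier generator of an arbitrary sequence of steps. -/
def stepGen (x : Fin m → ℕ) : RegularSpace K (ZMod n) m :=
  ∑ a ∈ Finset.range n, (((ζ⁻¹ ^ a : Kˣ) : K)) • elementary K (stepPath n (a : ZMod n) x)

theorem fourierGen_eq_stepGen {S : Finset ℕ} (w : Fin m → S) :
    fourierGen n ζ w = stepGen n ζ fun i => (w i : ℕ) := by
  simp only [fourierGen, stepGen, wordPath_eq_stepPath]

variable {n ζ} (hζ : ζ ^ n = 1)
include hζ

/-- The summand of the generator is n-periodic in a because ζⁿ = 1, so a may be replaced by a + s;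
the weight ζ^{-a} then accounts for the factor ζ^s. -/
theorem sum_range_stepGen (x : Fin m → ℕ) (s : ℕ) :
    ∑ a ∈ Finset.range n,
      (((ζ⁻¹ ^ a : Kˣ) : K)) • elementary K (stepPath n ((a : ZMod n) + s) x) =
      (ζ : K) ^ s • stepGen n ζ x := by
  have h := sum_range_shift (n := n)
    (f := fun a => (((ζ⁻¹ ^ a : Kˣ) : K)) • elementary K (stepPath n (a : ZMod n) x)) (fun a => by
      rw [pow_add, inv_pow ζ n, hζ, inv_one, mul_one, Nat.cast_add, ZMod.natCast_self, add_zero]) s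
  rw [stepGen, ← h, Finset.smul_sum]
  refine Finset.sum_congr rfl fun a _ => ?_
  rw [smul_smul, Nat.cast_add, ← Units.val_pow_eq_pow_val, ← Units.val_mul]
  congr 2
  rw [pow_add, mul_left_comm, ← mul_pow, mul_inv_cancel, one_pow, mul_one]

theorem shift_stepGen (x : Fin m → ℕ) :
    shift K n m (stepGen n ζ x) = (ζ : K) • stepGen n ζ x := by
  have h := sum_range_stepGen hζ x 1
  rw [pow_one] at h
  rw [← h]
  conv_lhs => rw [stepGen]
  simp only [map_sum, map_smul, shift_elementary, stepPath_add, Nat.cast_one]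

/-- Only the deletion of the first vertex moves the starting point, so the initial face alone
acquires a power of ζ. -/
theorem boundary_stepGen (x : Fin (m + 1) → ℕ) :
    boundary K _ m (stepGen n ζ x) = (ζ : K) ^ x 0 • stepGen n ζ (Fin.tail x) +
      ∑ j : Fin (m + 1), (-1 : K) ^ ((j : ℕ) + 1) •
        stepGen n ζ (Fin.contractNth j (· + ·) x) := by
  rw [← sum_range_stepGen hζ]
  simp only [stepGen, map_sum, map_smul, boundary_elementary, Fin.sum_univ_succ (n := m + 1),
    stepPath_tail, stepPath_contractNth, smul_add, Finset.sum_add_distrib]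
  congr 1
  · simp
  · simp only [Finset.smul_sum]
    rw [Finset.sum_comm]
    refine Finset.sum_congr rfl fun j _ => Finset.sum_congr rfl fun a _ => ?_
    rw [smul_comm, Fin.val_succ]

end Words

/-! ### Fourier generators as a basis of the allowed eigenvectors -/

section Modes

variable {K : Type*} [Field K] {n m : ℕ}

theorem stepPath_regular (a : ZMod n) {y : Fin m → ℕ} (hy : ∀ i, 0 < y i ∧ y i < n) (k : Fin m) :
    stepPath n a y k.castSucc ≠ stepPath n a y k.succ := by
  rw [stepPath_succ]
  intro h
  have h' : ((y k : ℕ) : ZMod n) = 0 := by simpa using h.symm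
  rw [ZMod.natCast_eq_zero_iff] at h'
  exact absurd (Nat.le_of_dvd (hy k).1 h') (not_le.2 (hy k).2)

theorem natCast_injOn_lt {a b : ℕ} (ha : a < n) (hb : b < n) (h : (a : ZMod n) = b) : a = b := by
  rw [ZMod.natCast_eq_natCast_iff', Nat.mod_eq_of_lt ha, Nat.mod_eq_of_lt hb] at h
  exact h

/-- Among the translates in the generator only a = 0 starts at vertex 0, and steps below n are
determined by their residues. -/
theorem coord_stepGen (hn : n ≠ 0) (ζ : Kˣ) {x y : Fin m → ℕ} (hx : ∀ i, x i < n)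
    (hy : ∀ i, 0 < y i ∧ y i < n) :
    coord K (stepPath n 0 y) (stepGen n ζ x) = if x = y then 1 else 0 := by
  classical
  simp only [stepGen, map_sum, map_smul, coord_elementary (stepPath_regular 0 hy)]
  rw [Finset.sum_eq_single_of_mem 0 (Finset.mem_range.2 (Nat.pos_of_ne_zero hn))]
  · simp only [pow_zero, Units.val_one, one_smul, Nat.cast_zero]
    refine if_congr ⟨fun h => funext fun i => ?_, fun h => by rw [h]⟩ rfl rfl
    have h1 := congrFun h i.succ
    rw [stepPath_succ, stepPath_succ, congrFun h i.castSucc] at h1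
    exact natCast_injOn_lt (hx i) (hy i).2 (add_left_cancel h1)
  · intro a ha ha0
    rw [if_neg, smul_zero]
    intro h
    have h1 := congrFun h 0
    rw [stepPath_zero, stepPath_zero] at h1
    exact ha0 (natCast_injOn_lt (Finset.mem_range.1 ha) (Nat.pos_of_ne_zero hn)
      (by simpa using h1))

theorem coord_shift {v : Fin (m + 1) → ZMod n} (hv : ∀ k : Fin m, v k.castSucc ≠ v k.succ)
    (x : RegularSpace K (ZMod n) m) :
    coord K (fun i => v i + 1) (shift K n m x) = coord K v x := by
  classical
  suffices h : coord K (fun i => v i + 1) ∘ₗ shift K n m = coord K v from LinearMap.congr_fun h x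
  refine regular_induction fun w => ?_
  have hv' : ∀ k : Fin m, v k.castSucc + 1 ≠ v k.succ + 1 := fun k h => hv k (add_right_cancel h)
  rw [LinearMap.comp_apply, shift_elementary, coord_elementary hv', coord_elementary hv]
  refine if_congr ⟨fun h => funext fun i => ?_, fun h => by rw [h]⟩ rfl rfl
  exact add_right_cancel (congrFun h i)

variable {S : Finset ℕ}

/-- The eigenvector equation determines the coefficients at starting vertex a + 1 from those at a,
so an eigenvector is known from its paths starting at 0. -/
theorem eq_zero_of_coord_wordPath_eq_zero (h0 : 0 ∉ S) (hn : NoWrap S n) {ζ : Kˣ}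
    {x : RegularSpace K (ZMod n) m} (hn0 : n ≠ 0)
    (hx : x ∈ allowed K (circulant n S) m) (hζ : shift K n m x = (ζ : K) • x)
    (h : ∀ w : Fin m → S, coord K (stepPath n 0 fun i => w i) x = 0) : x = 0 := by
  refine eq_zero_of_coord_eq_zero x fun v hv => ?_
  by_cases hG : ∀ k : Fin m, (circulant n S).Adj (v k.castSucc) (v k.succ)
  · choose s hs hvs using hG
    have hreg : ∀ i, 0 < s i ∧ s i < n := fun i =>
      ⟨Nat.pos_of_ne_zero fun h => h0 (h ▸ hs i), by have := hn _ (hs i); omega⟩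
    have key : ∀ a : ℕ, coord K (stepPath n (a : ZMod n) s) x = 0 := fun a => by
      induction a with
      | zero => simpa using h fun i => ⟨s i, hs i⟩
      | succ a ih =>
        have h1 := coord_shift (stepPath_regular (a : ZMod n) hreg) x
        simp only [stepPath_add, hζ, map_smul, ih, smul_eq_mul] at h1
        rw [Nat.cast_succ]
        exact (mul_eq_zero.1 h1).resolve_left ζ.ne_zero
    have : NeZero n := ⟨hn0⟩
    have h1 := key (v 0).val
    rw [ZMod.natCast_zmod_val, ← eq_stepPath n hvs] at h1
    exact h1
  · exact coord_eq_zero_of_mem_allowed hv hG hx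

variable (n) in
/-- The linear combinations of the Fourier generators. -/
def fourierMap (S : Finset ℕ) (ζ : Kˣ) (m : ℕ) :
    ((Fin m → S) → K) →ₗ[K] RegularSpace K (ZMod n) m :=
  Fintype.linearCombination K fun w => fourierGen n ζ w

theorem fourierMap_apply (ζ : Kˣ) (c : (Fin m → S) → K) :
    fourierMap n S ζ m c = ∑ w, c w • stepGen n ζ fun i => (w i : ℕ) := by
  simp [fourierMap, Fintype.linearCombination_apply, fourierGen_eq_stepGen]

theorem stepGen_mem_allowed (ζ : Kˣ) {x : Fin m → ℕ} (hx : ∀ i, x i ∈ S) :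
    stepGen n ζ x ∈ allowed K (circulant n S) m :=
  Submodule.sum_mem _ fun _ _ => Submodule.smul_mem _ _ <| elementary_mem_allowed K fun k =>
    ⟨x k, hx k, stepPath_succ n _ x k⟩

theorem fourierMap_mem_allowed (ζ : Kˣ) (c : (Fin m → S) → K) :
    fourierMap n S ζ m c ∈ allowed K (circulant n S) m := by
  rw [fourierMap_apply]
  exact Submodule.sum_mem _ fun w _ =>
    Submodule.smul_mem _ _ (stepGen_mem_allowed ζ fun i => (w i).2)

theorem shift_fourierMap {ζ : Kˣ} (hζ : ζ ^ n = 1) (c : (Fin m → S) → K) :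
    shift K n m (fourierMap n S ζ m c) = (ζ : K) • fourierMap n S ζ m c := by
  rw [fourierMap_apply, map_sum, Finset.smul_sum]
  exact Finset.sum_congr rfl fun w _ => by rw [map_smul, shift_stepGen hζ, smul_comm]

theorem coord_fourierMap (h0 : 0 ∉ S) (hn : NoWrap S n) (hn0 : n ≠ 0) (ζ : Kˣ)
    (c : (Fin m → S) → K) (w : Fin m → S) :
    coord K (stepPath n 0 fun i => w i) (fourierMap n S ζ m c) = c w := by
  classical
  have hlt : ∀ s : S, (s : ℕ) < n := fun s => by have := hn _ s.2; omega
  have hpos : ∀ s : S, 0 < (s : ℕ) := fun s => Nat.pos_of_ne_zero fun h => h0 (h ▸ s.2)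
  rw [fourierMap_apply, map_sum, Finset.sum_eq_single w]
  · rw [map_smul, coord_stepGen hn0 ζ (fun i => hlt _) fun i => ⟨hpos _, hlt _⟩, if_pos rfl,
      smul_eq_mul, mul_one]
  · intro w' _ hw
    rw [map_smul, coord_stepGen hn0 ζ (fun i => hlt _) fun i => ⟨hpos _, hlt _⟩, if_neg, smul_zero]
    exact fun h => hw (funext fun i => Subtype.ext (congrFun h i))
  · simp

theorem fourierMap_injective (h0 : 0 ∉ S) (hn : NoWrap S n) (hn0 : n ≠ 0) (ζ : Kˣ) :
    Function.Injective (fourierMap n S ζ m) := fun c c' h => funext fun w => by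
  rw [← coord_fourierMap h0 hn hn0 ζ c w, h, coord_fourierMap h0 hn hn0 ζ c' w]

theorem fourierMap_coord (h0 : 0 ∉ S) (hn : NoWrap S n) (hn0 : n ≠ 0) {ζ : Kˣ} (hζ : ζ ^ n = 1)
    {x : RegularSpace K (ZMod n) m} (hx : x ∈ allowed K (circulant n S) m)
    (hx' : shift K n m x = (ζ : K) • x) :
    fourierMap n S ζ m (fun w => coord K (stepPath n 0 fun i => w i) x) = x := by
  rw [← sub_eq_zero]
  refine eq_zero_of_coord_wordPath_eq_zero h0 hn hn0 (ζ := ζ)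
    (sub_mem (fourierMap_mem_allowed ζ _) hx) ?_ fun w => ?_
  · rw [map_sub, shift_fourierMap hζ, hx', smul_sub]
  · rw [map_sub, coord_fourierMap h0 hn hn0, sub_self]

end Modes

end PathHomology
end

noncomputable section

namespace PathHomology

/-! ### Kernels of matrices, witnessed by identities -/

section GeneralizedInverse

/-- Over a field, the kernel of a matrix `A` has a basis (the columns of `W`) such that the
identities witnessing this persist in every algebra. -/
theorem exists_kernel_matrices {F X Y : Type*} [Field F] [Fintype X] [Fintype Y] [DecidableEq X]
    (A : Matrix Y X F) : ∃ (d : ℕ) (W : Matrix X (Fin d) F) (L : Matrix (Fin d) X F)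
      (B : Matrix X Y F), A * W = 0 ∧ L * W = 1 ∧ W * L + B * A = 1 := by
  classical
  let f := Matrix.toLin' A
  obtain ⟨r, hr⟩ := f.rangeRestrict.exists_rightInverse_of_surjective f.range_rangeRestrict
  obtain ⟨p, hp⟩ := (LinearMap.range f).subtype.exists_leftInverse_of_injective
    (Submodule.ker_subtype _)
  let b := Module.finBasis F (LinearMap.ker f)
  -- The composite r ∘ p is a generalized inverse g of f: from fgf = f it follows that 1 − gf
  -- projects onto the kernel.
  have hB : ∀ x, f (r (p (f x))) = f x := fun x => by
    have h1 : p (f x) = f.rangeRestrict x := LinearMap.congr_fun hp (f.rangeRestrict x)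
    rw [h1]
    exact congrArg Subtype.val (LinearMap.congr_fun hr (f.rangeRestrict x))
  let q : (X → F) →ₗ[F] LinearMap.ker f :=
    (LinearMap.id - r ∘ₗ p ∘ₗ f).codRestrict _ fun x => by simp [hB]
  let w : (Fin _ → F) →ₗ[F] (X → F) := (LinearMap.ker f).subtype ∘ₗ b.equivFun.symm.toLinearMap
  let l : (X → F) →ₗ[F] (Fin _ → F) := b.equivFun.toLinearMap ∘ₗ q
  have hfw : f ∘ₗ w = 0 := LinearMap.ext fun x => (b.equivFun.symm x).2
  have hq : ∀ x : LinearMap.ker f, q x = x := fun x => Subtype.ext <| by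
    simp [q, LinearMap.mem_ker.1 x.2]
  have hlw : l ∘ₗ w = LinearMap.id := LinearMap.ext fun x => by
    simp only [l, w, LinearMap.comp_apply, LinearEquiv.coe_coe, Submodule.subtype_apply, hq,
      LinearEquiv.apply_symm_apply, LinearMap.id_apply]
  have hwl : w ∘ₗ l + (r ∘ₗ p) ∘ₗ f = LinearMap.id := LinearMap.ext fun x => by
    simp [l, w, q]
  refine ⟨_, LinearMap.toMatrix' w, LinearMap.toMatrix' l, LinearMap.toMatrix' (r ∘ₗ p),
    ?_, ?_, ?_⟩
  · rw [← LinearMap.toMatrix'_toLin' A, ← LinearMap.toMatrix'_comp]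
    exact (congrArg LinearMap.toMatrix' hfw).trans (map_zero _)
  · rw [← LinearMap.toMatrix'_comp, hlw, LinearMap.toMatrix'_id]
  · rw [← LinearMap.toMatrix'_toLin' A, ← LinearMap.toMatrix'_comp, ← LinearMap.toMatrix'_comp,
      ← map_add]
    exact (congrArg LinearMap.toMatrix' hwl).trans LinearMap.toMatrix'_id

end GeneralizedInverse

/-! ### The conditions defining Ω in terms of step words -/

section Faces

variable (S : Finset ℕ) (m : ℕ) (R : Type*) [CommRing R]

/-- The coefficient of the step word `y` among the inner and final faces of `x`. -/
def innerCoeff {m : ℕ} (x : Fin (m + 1) → ℕ) (y : Fin m → ℕ) : R :=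
  ∑ j : Fin (m + 1), if y = Fin.contractNth j (· + ·) x then (-1) ^ ((j : ℕ) + 1) else 0

/-- The matrix of the allowed part of the boundary in terms of the Fourier generators. -/
def faceMatrix (t : R) : Matrix (Fin m → S) (Fin (m + 1) → S) R :=
  Matrix.of fun y w => (if y = Fin.tail w then t ^ (w 0 : ℕ) else 0) +
    innerCoeff R (fun i => (w i : ℕ)) (fun i => (y i : ℕ))

/-- The possible steps of the faces of allowed paths: elements of `S` and sums of two of them. -/
def faceSteps : Finset ℕ := S ∪ Finset.image₂ (· + ·) S S

open Classical in
/-- The matrix of the non-allowed part of the boundary in terms of the Fourier generators. -/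
def obstructionMatrix : Matrix (Fin m → faceSteps S) (Fin (m + 1) → S) R :=
  Matrix.of fun y w => if ∀ i, (y i : ℕ) ∈ S then 0 else
    innerCoeff R (fun i => (w i : ℕ)) (fun i => (y i : ℕ))

/-- The matrix of the linear conditions defining `Ω_m` in terms of the Fourier generators. -/
def constraintMatrix : (m : ℕ) → Matrix (Fin (m - 1) → faceSteps S) (Fin m → S) R
  | 0 => 0
  | m + 1 => obstructionMatrix S m R

variable {R} {m} {R' : Type*} [CommRing R'] (f : R →+* R')

theorem map_innerCoeff (x : Fin (m + 1) → ℕ) (y : Fin m → ℕ) :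
    f (innerCoeff R x y) = innerCoeff R' x y := by
  simp only [innerCoeff, map_sum]
  exact Finset.sum_congr rfl fun j _ => by split_ifs <;> simp

theorem map_faceMatrix (t : R) : (faceMatrix S m R t).map f = faceMatrix S m R' (f t) := by
  ext y w
  simp only [faceMatrix, Matrix.map_apply, Matrix.of_apply, map_add, map_innerCoeff]
  congr 1
  split_ifs <;> simp

theorem map_obstructionMatrix :
    (obstructionMatrix S m R).map f = obstructionMatrix S m R' := by
  ext y w
  simp only [obstructionMatrix, Matrix.map_apply, Matrix.of_apply]
  split_ifs
  · simp
  · exact map_innerCoeff f _ _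

theorem map_constraintMatrix (m : ℕ) :
    (constraintMatrix S R m).map f = constraintMatrix S R' m := by
  cases m with
  | zero => exact Matrix.map_zero _ (map_zero f)
  | succ m => exact map_obstructionMatrix S f

variable {S}

theorem subset_faceSteps : S ⊆ faceSteps S := Finset.subset_union_left

/-- This is the role of the bound s < n/2: merged steps stay strictly between 0 and n, so faces are
regular and different face words have different vertex sequences modulo n. -/
theorem faceSteps_bounds (h0 : 0 ∉ S) {n : ℕ} (hn : NoWrap S n) {s : ℕ} (hs : s ∈ faceSteps S) :
    0 < s ∧ s < n := by
  have h : ∀ s ∈ S, 0 < s ∧ 2 * s < n := fun s hs =>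
    ⟨Nat.pos_of_ne_zero fun h => h0 (h ▸ hs), hn s hs⟩
  rcases Finset.mem_union.1 hs with hs | hs
  · have := h s hs
    omega
  · obtain ⟨a, ha, b, hb, rfl⟩ := Finset.mem_image₂.1 hs
    have := h a ha
    have := h b hb
    omega

theorem contractNth_mem_faceSteps (w : Fin (m + 1) → S) (j : Fin (m + 1)) (i : Fin m) :
    Fin.contractNth j (· + ·) (fun i => (w i : ℕ)) i ∈ faceSteps S := by
  simp only [Fin.contractNth]
  split_ifs
  · exact subset_faceSteps (w _).2
  · exact Finset.mem_union_right _ (Finset.mem_image₂_of_mem (w _).2 (w _).2)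
  · exact subset_faceSteps (w _).2

variable {K : Type*} [Field K] {n : ℕ} {ζ : Kˣ}

theorem boundary_fourierMap (hζ : ζ ^ n = 1) (c : (Fin (m + 1) → S) → K) :
    boundary K _ m (fourierMap n S ζ (m + 1) c) =
      fourierMap n S ζ m (fun y => ∑ w, (if y = Fin.tail w then (ζ : K) ^ (w 0 : ℕ) else 0) * c w) +
      ∑ y : Fin m → faceSteps S,
        (∑ w, innerCoeff K (fun i => (w i : ℕ)) (fun i => (y i : ℕ)) * c w) •
          stepGen n ζ fun i => (y i : ℕ) := by
  classical
  simp only [fourierMap_apply, map_sum, map_smul, boundary_stepGen hζ, smul_add,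
    Finset.sum_add_distrib, Finset.sum_smul]
  congr 1
  · rw [Finset.sum_comm]
    refine Finset.sum_congr rfl fun w _ => ?_
    rw [Finset.sum_eq_single (Fin.tail w)]
    · rw [if_pos rfl, smul_smul, mul_comm]
      rfl
    · intro y _ hy
      rw [if_neg hy, zero_mul, zero_smul]
    · simp
  · rw [Finset.sum_comm]
    refine Finset.sum_congr rfl fun w _ => ?_
    simp only [innerCoeff, Finset.sum_mul, Finset.sum_smul, Finset.smul_sum]
    rw [Finset.sum_comm]
    refine Finset.sum_congr rfl fun j _ => ?_
    rw [Finset.sum_eq_single fun i => ⟨_, contractNth_mem_faceSteps w j i⟩]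
    · rw [if_pos rfl, smul_smul, mul_comm]
    · intro y _ hy
      rw [if_neg, zero_mul, zero_smul]
      exact fun h => hy (funext fun i => Subtype.ext (congrFun h i))
    · simp

theorem coord_boundary_fourierMap (h0 : 0 ∉ S) (hn : NoWrap S n) (hn0 : n ≠ 0) (hζ : ζ ^ n = 1)
    (c : (Fin (m + 1) → S) → K) (y : Fin m → S) :
    coord K (stepPath n 0 fun i => y i) (boundary K _ m (fourierMap n S ζ (m + 1) c)) =
      (faceMatrix S m K (ζ : K)).mulVec c y := by
  classical
  have hb : ∀ s : faceSteps S, 0 < (s : ℕ) ∧ (s : ℕ) < n := fun s => faceSteps_bounds h0 hn s.2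
  let y' : Fin m → faceSteps S := fun i => ⟨y i, subset_faceSteps (y i).2⟩
  rw [boundary_fourierMap hζ, map_add, coord_fourierMap h0 hn hn0, map_sum,
    Finset.sum_eq_single y']
  · rw [map_smul, coord_stepGen (y := fun i => (y i : ℕ)) hn0 ζ (fun i => (hb _).2)
      (fun i => hb (y' i)), if_pos rfl, smul_eq_mul, mul_one, ← Finset.sum_add_distrib]
    simp only [Matrix.mulVec, dotProduct, faceMatrix, Matrix.of_apply, add_mul, y']
  · intro x _ hx
    rw [map_smul, coord_stepGen (y := fun i => (y i : ℕ)) hn0 ζ (fun i => (hb _).2)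
      (fun i => hb (y' i)), if_neg, smul_zero]
    exact fun h => hx (funext fun i => Subtype.ext (congrFun h i))
  · simp

/-- The initial face is a word in S and never obstructs. The coefficients of the non-allowed face
words, read off at starting vertex 0, must vanish separately, and these conditions contain neither n
nor ζ. -/
theorem fourierMap_mem_Omega_iff (h0 : 0 ∉ S) (hn : NoWrap S n) (hn0 : n ≠ 0) (hζ : ζ ^ n = 1)
    (c : (Fin (m + 1) → S) → K) :
    fourierMap n S ζ (m + 1) c ∈ Omega K (circulant n S) (m + 1) ↔
      (obstructionMatrix S m K).mulVec c = 0 := by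
  classical
  have hb : ∀ s : faceSteps S, 0 < (s : ℕ) ∧ (s : ℕ) < n := fun s => faceSteps_bounds h0 hn s.2
  have hmul : ∀ y : Fin m → faceSteps S, (obstructionMatrix S m K).mulVec c y =
      if ∀ i, (y i : ℕ) ∈ S then 0 else
        ∑ w, innerCoeff K (fun i => (w i : ℕ)) (fun i => (y i : ℕ)) * c w := fun y => by
    simp only [Matrix.mulVec, dotProduct, obstructionMatrix, Matrix.of_apply]
    split_ifs <;> simp
  refine ⟨fun h => funext fun y => ?_, fun h => ⟨fourierMap_mem_allowed ζ c, ?_⟩⟩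
  · rw [hmul]
    split_ifs with hy
    · rfl
    -- A step outside S could be an arrow only by being congruent to some s ∈ S; both are below n,
    -- so they would be equal.
    have hy' : ¬ ∀ k : Fin m, (circulant n S).Adj (stepPath n 0 (fun i => (y i : ℕ)) k.castSucc)
        (stepPath n 0 (fun i => (y i : ℕ)) k.succ) := by
      intro hadj
      refine hy fun i => ?_
      obtain ⟨s, hs, hsi⟩ := hadj i
      rw [stepPath_succ] at hsi
      rw [natCast_injOn_lt (hb _).2 (faceSteps_bounds h0 hn (subset_faceSteps hs)).2
        (add_left_cancel hsi)]
      exact hs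
    have h1 := coord_eq_zero_of_mem_allowed (stepPath_regular 0 fun i => hb (y i)) hy' h.2
    rw [boundary_fourierMap hζ, map_add, coord_eq_zero_of_mem_allowed
      (stepPath_regular 0 fun i => hb (y i)) hy' (fourierMap_mem_allowed ζ _), zero_add, map_sum,
      Finset.sum_eq_single y] at h1
    · rwa [map_smul, coord_stepGen hn0 ζ (fun i => (hb _).2) (fun i => hb _), if_pos rfl,
        smul_eq_mul, mul_one] at h1
    · intro x _ hx
      rw [map_smul, coord_stepGen hn0 ζ (fun i => (hb _).2) (fun i => hb _), if_neg, smul_zero]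
      exact fun h => hx (funext fun i => Subtype.ext (congrFun h i))
    · simp
  · rw [SetLike.mem_coe, Submodule.mem_comap, boundary_fourierMap hζ]
    refine add_mem (fourierMap_mem_allowed ζ _) (Submodule.sum_mem _ fun y _ => ?_)
    by_cases hy : ∀ i, (y i : ℕ) ∈ S
    · exact Submodule.smul_mem _ _ (stepGen_mem_allowed ζ hy)
    · have h1 := congrFun h y
      rw [hmul, if_neg hy] at h1
      rw [h1]
      simp

theorem fourierMap_mem_Omega_iff_constraint (h0 : 0 ∉ S) (hn : NoWrap S n) (hn0 : n ≠ 0)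
    (hζ : ζ ^ n = 1) (m : ℕ) (c : (Fin m → S) → K) :
    fourierMap n S ζ m c ∈ Omega K (circulant n S) m ↔
      (constraintMatrix S K m).mulVec c = 0 := by
  cases m with
  | zero => exact iff_of_true (fourierMap_mem_allowed ζ c) (Matrix.zero_mulVec c)
  | succ m => exact fourierMap_mem_Omega_iff h0 hn hn0 hζ c

theorem boundary_fourierMap_of_mem_Omega (h0 : 0 ∉ S) (hn : NoWrap S n) (hn0 : n ≠ 0)
    (hζ : ζ ^ n = 1) {c : (Fin (m + 1) → S) → K}
    (hc : fourierMap n S ζ (m + 1) c ∈ Omega K (circulant n S) (m + 1)) :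
    boundary K _ m (fourierMap n S ζ (m + 1) c) =
      fourierMap n S ζ m ((faceMatrix S m K (ζ : K)).mulVec c) := by
  rw [← fourierMap_coord h0 hn hn0 hζ hc.2 (by rw [← boundary_shift, shift_fourierMap hζ, map_smul])]
  congr 1
  funext y
  exact coord_boundary_fourierMap h0 hn hn0 hζ c y

end Faces

end PathHomology
end

noncomputable section

/-! ### A rational basis valid in all blocks -/

namespace PathHomology

/-- Rational bases of the coefficient vectors of the spaces `Ω_m`, together with matrices which
witness the basis property over all fields of characteristic zero. -/
structure OmegaBasis (S : Finset ℕ) where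
  /-- the dimension of the blocks -/
  dim : ℕ → ℕ
  /-- the basis vectors -/
  basis : (m : ℕ) → Matrix (Fin m → S) (Fin (dim m)) ℚ
  /-- the coordinates -/
  coords : (m : ℕ) → Matrix (Fin (dim m)) (Fin m → S) ℚ
  /-- the factor of the complementary projection -/
  factor : (m : ℕ) → Matrix (Fin m → S) (Fin (m - 1) → faceSteps S) ℚ
  constraint_mul_basis : ∀ m, constraintMatrix S ℚ m * basis m = 0
  coords_mul_basis : ∀ m, coords m * basis m = 1
  basis_mul_coords : ∀ m, basis m * coords m + factor m * constraintMatrix S ℚ m = 1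

theorem nonempty_omegaBasis (S : Finset ℕ) : Nonempty (OmegaBasis S) := by
  choose d W L B h1 h2 h3 using fun m => exists_kernel_matrices (constraintMatrix S ℚ m)
  exact ⟨⟨d, W, L, B, h1, h2, h3⟩⟩

namespace OmegaBasis

variable {S : Finset ℕ} (E : OmegaBasis S)

/-- The boundary in the coordinates of the basis, for a parameter `t` of a `ℚ`-algebra. -/
def differential {R : Type*} [CommRing R] [Algebra ℚ R] (k : ℕ) (t : R) :
    Matrix (Fin (E.dim k)) (Fin (E.dim (k + 1))) R :=
  (E.coords k).map (algebraMap ℚ R) * faceMatrix S k R t * (E.basis (k + 1)).map (algebraMap ℚ R)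

theorem map_differential {R R' : Type*} [CommRing R] [Algebra ℚ R] [CommRing R'] [Algebra ℚ R']
    (f : R →+* R') (k : ℕ) (t : R) :
    (E.differential k t).map f = E.differential k (f t) := by
  have h : ⇑f ∘ ⇑(algebraMap ℚ R) = algebraMap ℚ R' :=
    congrArg DFunLike.coe (Subsingleton.elim (f.comp (algebraMap ℚ R)) (algebraMap ℚ R'))
  rw [differential, Matrix.map_mul, Matrix.map_mul, map_faceMatrix, Matrix.map_map, Matrix.map_map,
    h, differential]

variable {K : Type*} [Field K] [CharZero K] {n : ℕ} {ζ : Kˣ}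

/-- The three matrix identities over ℚ survive extension of scalars, so the same columns span the
kernel over every K. -/
theorem basis_coords_mulVec_eq_iff (m : ℕ) (c : (Fin m → S) → K) :
    ((E.basis m).map (algebraMap ℚ K)).mulVec (((E.coords m).map (algebraMap ℚ K)).mulVec c) = c ↔
      (constraintMatrix S K m).mulVec c = 0 := by
  rw [← map_constraintMatrix S (algebraMap ℚ K)]
  refine ⟨fun h => ?_, fun h => ?_⟩
  · rw [← h, Matrix.mulVec_mulVec, ← Matrix.map_mul, E.constraint_mul_basis,
      Matrix.map_zero _ (map_zero _), Matrix.zero_mulVec]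
  · have h4 := congrArg (fun M => (M.map (algebraMap ℚ K)).mulVec c) (E.basis_mul_coords m)
    simp only [Matrix.map_add _ (map_add (algebraMap ℚ K)), Matrix.map_mul, Matrix.add_mulVec,
      ← Matrix.mulVec_mulVec, h, Matrix.mulVec_zero, add_zero,
      Matrix.map_one _ (map_zero (algebraMap ℚ K)) (map_one (algebraMap ℚ K)),
      Matrix.one_mulVec] at h4
    exact h4

theorem coords_basis_mulVec (m : ℕ) (x : Fin (E.dim m) → K) :
    ((E.coords m).map (algebraMap ℚ K)).mulVec (((E.basis m).map (algebraMap ℚ K)).mulVec x) =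
      x := by
  rw [Matrix.mulVec_mulVec, ← Matrix.map_mul, E.coords_mul_basis,
    Matrix.map_one _ (map_zero _) (map_one _), Matrix.one_mulVec]

variable (n ζ) in
/-- The parametrization of the blocks by their coordinates. -/
def param (m : ℕ) : (Fin (E.dim m) → K) →ₗ[K] RegularSpace K (ZMod n) m :=
  fourierMap n S ζ m ∘ₗ ((E.basis m).map (algebraMap ℚ K)).mulVecLin

theorem param_apply (m : ℕ) (x : Fin (E.dim m) → K) : E.param n ζ m x =
    fourierMap n S ζ m (((E.basis m).map (algebraMap ℚ K)).mulVec x) := rfl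

variable (h0 : 0 ∉ S) (hn : NoWrap S n) (hn0 : n ≠ 0)
include h0 hn hn0

theorem param_injective (m : ℕ) : Function.Injective (E.param n ζ m) := fun x y h => by
  have h' : ((E.basis m).map (algebraMap ℚ K)).mulVec x =
      ((E.basis m).map (algebraMap ℚ K)).mulVec y := fourierMap_injective h0 hn hn0 ζ h
  rw [← E.coords_basis_mulVec m x, h', E.coords_basis_mulVec]

variable (hζ : ζ ^ n = 1)
include hζ

theorem param_mem_Omega (m : ℕ) (x : Fin (E.dim m) → K) :
    E.param n ζ m x ∈ Omega K (circulant n S) m := by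
  rw [param_apply, fourierMap_mem_Omega_iff_constraint h0 hn hn0 hζ,
    ← E.basis_coords_mulVec_eq_iff, E.coords_basis_mulVec]

theorem range_param (m : ℕ) : LinearMap.range (E.param n ζ m) = OmegaMode n S ζ m := by
  refine le_antisymm ?_ fun y hy => ?_
  · rintro _ ⟨x, rfl⟩
    exact mem_OmegaMode.2 ⟨E.param_mem_Omega h0 hn hn0 hζ m x, shift_fourierMap hζ _⟩
  · obtain ⟨hy1, hy2⟩ := mem_OmegaMode.1 hy
    have h := fourierMap_coord h0 hn hn0 hζ (Omega_le_allowed K _ _ hy1) hy2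
    rw [← h, fourierMap_mem_Omega_iff_constraint h0 hn hn0 hζ,
      ← E.basis_coords_mulVec_eq_iff] at hy1
    exact ⟨_, by rw [param_apply, hy1, h]⟩

theorem boundary_param (m : ℕ) (x : Fin (E.dim (m + 1)) → K) :
    boundary K _ m (E.param n ζ (m + 1) x) =
      E.param n ζ m ((E.differential m (ζ : K)).mulVec x) := by
  have hx := E.param_mem_Omega h0 hn hn0 hζ (m + 1) x
  rw [param_apply] at hx
  have h := boundary_fourierMap_of_mem_Omega h0 hn hn0 hζ hx
  have h' := boundary_mem_Omega K hx
  rw [h, fourierMap_mem_Omega_iff_constraint h0 hn hn0 hζ,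
    ← E.basis_coords_mulVec_eq_iff] at h'
  rw [param_apply, h, ← h', param_apply, differential]
  simp only [Matrix.mulVec_mulVec, Matrix.mul_assoc]

theorem differential_mul_differential_of_root (m : ℕ) :
    E.differential m (ζ : K) * E.differential (m + 1) (ζ : K) = 0 := by
  refine Matrix.ext_of_mulVec_single fun i => ?_
  apply E.param_injective (ζ := ζ) h0 hn hn0 m
  rw [← Matrix.mulVec_mulVec, ← E.boundary_param h0 hn hn0 hζ, ← E.boundary_param h0 hn hn0 hζ,
    boundary_boundary, Matrix.zero_mulVec, map_zero]

theorem exists_differential_mulVec_eq (h1 : 1 ∈ S) (hζ1 : ζ ≠ 1) (m : ℕ) (x : Fin (E.dim m) → K)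
    (hx : x ∈ coordCycles (fun k => E.differential k (ζ : K)) m) :
    ∃ y, (E.differential m (ζ : K)).mulVec y = x := by
  have hcyc : E.param n ζ m x ∈ cycles (OmegaMode n S ζ) m := by
    have hmem : E.param n ζ m x ∈ OmegaMode n S ζ m := by
      rw [← E.range_param h0 hn hn0 hζ]
      exact LinearMap.mem_range_self _ x
    cases m with
    | zero => exact hmem
    | succ m =>
      refine ⟨hmem, ?_⟩
      rw [SetLike.mem_coe, LinearMap.mem_ker, E.boundary_param h0 hn hn0 hζ]
      exact (congrArg _ hx).trans (map_zero _)
  obtain ⟨y, hy, hyx⟩ := exists_boundary_eq_of_mem_cycles h1 hζ1 hcyc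
  rw [← E.range_param h0 hn hn0 hζ] at hy
  obtain ⟨y, rfl⟩ := hy
  rw [E.boundary_param h0 hn hn0 hζ] at hyx
  exact ⟨y, E.param_injective h0 hn hn0 m hyx⟩

end OmegaBasis

end PathHomology
end

noncomputable section

namespace PathHomology

/-! ### Laurent polynomials: principal ideals, denominators, roots of unity -/

section Laurent

/-- F[t,t⁻¹] is a localization of F[t], so every ideal is extended from its contraction, which is
principal. -/
instance isPrincipalIdealRing_laurentPolynomial (F : Type*) [Field F] :
    IsPrincipalIdealRing F[T;T⁻¹] := by
  refine ⟨fun J => ?_⟩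
  obtain ⟨p, hp⟩ := IsPrincipalIdealRing.principal (Ideal.under (Polynomial F) J)
  refine ⟨algebraMap _ _ p, ?_⟩
  rw [← IsLocalization.map_under (Submonoid.powers (Polynomial.X : Polynomial F)) F[T;T⁻¹] J, hp]
  exact (Ideal.map_span _ _).trans (by rw [Set.image_singleton])

/-- Integral Laurent polynomials as rational ones. -/
def intToRat : ℤ[T;T⁻¹] →+* ℚ[T;T⁻¹] := AddMonoidAlgebra.mapRingHom ℤ (Int.castRingHom ℚ)

theorem intToRat_injective : Function.Injective intToRat := fun p q h => by
  ext n
  have := congrArg (fun r => r.coeff n) h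
  simpa [intToRat] using this

theorem intToRat_C_mul_T (a : ℤ) (n : ℤ) :
    intToRat (LaurentPolynomial.C a * LaurentPolynomial.T n) =
      LaurentPolynomial.C (a : ℚ) * LaurentPolynomial.T n := by
  rw [← LaurentPolynomial.single_eq_C_mul_T, ← LaurentPolynomial.single_eq_C_mul_T]
  exact AddMonoidAlgebra.mapRingHom_single _ _ _

variable {K : Type*} [Field K] [CharZero K]

/-- The value of a rational Laurent polynomial at a unit. -/
def ratEval (ζ : Kˣ) : ℚ[T;T⁻¹] →+* K := LaurentPolynomial.eval₂ (algebraMap ℚ K) ζ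

theorem ratEval_T (ζ : Kˣ) : ratEval ζ (LaurentPolynomial.T 1) = ζ := by
  simp [ratEval]

theorem ratEval_intToRat (ζ : Kˣ) (p : ℤ[T;T⁻¹]) : ratEval ζ (intToRat p) = evalAt ζ p := by
  induction p using LaurentPolynomial.induction_on' with
  | add p q hp hq => rw [map_add, map_add, map_add, hp, hq]
  | C_mul_T n a => rw [intToRat_C_mul_T]; simp [ratEval, evalAt]

theorem exists_intToRat_eq_smul (p : ℚ[T;T⁻¹]) :
    ∃ (e : ℤ) (q : ℤ[T;T⁻¹]), e ≠ 0 ∧ intToRat q = (e : ℚ[T;T⁻¹]) * p := by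
  induction p using LaurentPolynomial.induction_on' with
  | add p q hp hq =>
    obtain ⟨e, p', he, hp⟩ := hp
    obtain ⟨f, q', hf, hq⟩ := hq
    refine ⟨e * f, f * p' + e * q', mul_ne_zero he hf, ?_⟩
    rw [map_add, map_mul, map_mul, hp, hq, map_intCast, map_intCast]
    push_cast
    ring
  | C_mul_T n a =>
    refine ⟨a.den, LaurentPolynomial.C a.num * LaurentPolynomial.T n,
      Int.natCast_ne_zero.2 a.den_ne_zero, ?_⟩
    rw [intToRat_C_mul_T, ← mul_assoc]
    congr 1
    rw [← map_intCast (LaurentPolynomial.C (R := ℚ)), ← map_mul, mul_comm, Int.cast_natCast,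
      Rat.mul_den_eq_num]

theorem exists_intToRat_eq_mul {ι : Type*} [Finite ι] (p : ι → ℚ[T;T⁻¹]) :
    ∃ e : ℤ, e ≠ 0 ∧ ∀ i, ∃ q, intToRat q = (e : ℚ[T;T⁻¹]) * p i := by
  classical
  have := Fintype.ofFinite ι
  choose e q he hq using fun i => exists_intToRat_eq_smul (p i)
  refine ⟨∏ i, e i, Finset.prod_ne_zero_iff.2 fun i _ => he i, fun i =>
    ⟨(∏ j ∈ Finset.univ.erase i, e j : ℤ) * q i, ?_⟩⟩
  rw [map_mul, map_intCast, hq, ← mul_assoc, ← Int.cast_mul,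
    Finset.prod_erase_mul _ _ (Finset.mem_univ i)]

/-- A Laurent polynomial vanishing at all roots of unity of infinitely many orders is zero. -/
theorem eq_zero_of_ratEval_roots_eq_zero {p : ℚ[T;T⁻¹]} (N : ℕ)
    (h : ∀ n, N < n → ∀ ζ : ℂˣ, ζ ^ n = 1 → ratEval ζ p = 0) : p = 0 := by
  obtain ⟨k, f, hf⟩ := p.exists_T_pow
  suffices hf0 : f = 0 by
    rw [hf0, map_zero] at hf
    have := congrArg (· * LaurentPolynomial.T (-k)) hf.symm
    simpa only [LaurentPolynomial.mul_T_assoc, add_neg_cancel, LaurentPolynomial.T_zero, mul_one,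
      zero_mul] using this
  rw [← Polynomial.map_eq_zero_iff (algebraMap ℚ ℂ).injective]
  -- This n lies in the permitted range and exceeds the degree of f, which then has too many roots.
  set n := N + f.natDegree + 1 with hn
  have hprim := Complex.isPrimitiveRoot_exp n (by omega)
  refine Polynomial.eq_zero_of_natDegree_lt_card_of_eval_eq_zero' _
    (Polynomial.nthRootsFinset n (1 : ℂ)) (fun x hx => ?_) ?_
  · rw [Polynomial.mem_nthRootsFinset (by omega)] at hx
    have hx0 : x ≠ 0 := by
      rintro rfl
      rw [zero_pow (by omega)] at hx
      exact zero_ne_one hx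
    have h1 := h n (by omega) (Units.mk0 x hx0) (Units.ext (by simpa using hx))
    have h2 := congrArg (ratEval (Units.mk0 x hx0)) hf
    rw [map_mul, h1, zero_mul, ratEval, LaurentPolynomial.eval₂_toLaurent] at h2
    rw [Polynomial.eval_map]
    exact h2
  · rw [hprim.card_nthRootsFinset]
    exact lt_of_le_of_lt Polynomial.natDegree_map_le (by omega)

end Laurent

/-! ### Bases adapted to a kernel over a principal ideal domain -/

section KernelBasis

variable {R : Type*} [CommRing R]

/-- Over a principal ideal domain, the kernel of a matrix has an adapted basis. -/
theorem exists_adapted_basis [IsDomain R] [IsPrincipalIdealRing R] {a b : ℕ}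
    (M : Matrix (Fin b) (Fin a) R) : ∃ (z c : ℕ) (G : Matrix (Fin a) (Fin (z + c)) R)
      (H : Matrix (Fin (z + c)) (Fin a) R), G * H = 1 ∧ H * G = 1 ∧
        ∀ x, M.mulVec x = 0 ↔ ∀ j, H.mulVec x (Fin.natAdd z j) = 0 := by
  classical
  let f := Matrix.toLin' M
  obtain ⟨c, ⟨bc⟩⟩ := Submodule.nonempty_basis_of_pid (Pi.basisFun R (Fin b)) (LinearMap.range f)
  obtain ⟨z, ⟨bz⟩⟩ := Submodule.nonempty_basis_of_pid (Pi.basisFun R (Fin a)) (LinearMap.ker f)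
  have hfree : Module.Free R (LinearMap.range f) := Module.Free.of_basis bc
  -- The range is a submodule of a free module over a principal ideal domain, hence free. So f
  -- splits onto its range, and the domain is the direct sum of kernel and range.
  obtain ⟨r, hr⟩ := f.rangeRestrict.exists_rightInverse_of_surjective f.range_rangeRestrict
  have hr' : ∀ y, f (r y) = y := fun y => congrArg Subtype.val (LinearMap.congr_fun hr y)
  let q : (Fin a → R) →ₗ[R] LinearMap.ker f :=
    (LinearMap.id - r ∘ₗ f.rangeRestrict).codRestrict _ fun x => by
      simp only [LinearMap.mem_ker, LinearMap.sub_apply, map_sub, LinearMap.comp_apply, hr',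
        LinearMap.id_apply]
      exact sub_self _
  let e : (Fin a → R) ≃ₗ[R] (LinearMap.ker f) × (LinearMap.range f) :=
    LinearEquiv.ofLinearMap (q.prod f.rangeRestrict)
      ((LinearMap.ker f).subtype.coprod r)
      (by
        refine LinearMap.ext fun ⟨x, y⟩ => Prod.ext (Subtype.ext ?_) (Subtype.ext ?_)
        · have h1 : f.rangeRestrict x = 0 := Subtype.ext x.2
          have h2 : f.rangeRestrict (r y) = y := Subtype.ext (hr' y)
          simp [q, h1, h2]
        · simp [hr', LinearMap.mem_ker.1 x.2])
      (by
        refine LinearMap.ext fun x => ?_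
        simp [q])
  let B : Module.Basis (Fin (z + c)) R (Fin a → R) :=
    ((bz.prod bc).map e.symm).reindex finSumFinEquiv
  refine ⟨z, c, LinearMap.toMatrix' (B.equivFun.symm : _ →ₗ[R] _),
    LinearMap.toMatrix' (B.equivFun : _ →ₗ[R] _), ?_, ?_, fun x => ?_⟩
  · rw [← LinearMap.toMatrix'_comp, LinearEquiv.symm_comp, LinearMap.toMatrix'_id]
  · rw [← LinearMap.toMatrix'_comp, LinearEquiv.comp_symm, LinearMap.toMatrix'_id]
  -- The last c coordinates of x are the coordinates of f x in the range, so they vanish exactly on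
  -- the kernel.
  · have h1 : ∀ j, (LinearMap.toMatrix' (B.equivFun : _ →ₗ[R] _)).mulVec x (Fin.natAdd z j) =
        bc.repr (f.rangeRestrict x) j := fun j => by
      rw [LinearMap.toMatrix'_mulVec]
      simp [B, e]
    simp only [h1]
    have h2 : (∀ j, bc.repr (f.rangeRestrict x) j = 0) ↔ f.rangeRestrict x = 0 := by
      rw [← bc.repr.map_eq_zero_iff, Finsupp.ext_iff]
      rfl
    rw [h2, ← Matrix.toLin'_apply, Subtype.ext_iff]
    rfl

end KernelBasis

/-! ### Matrices with a single nonzero block -/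

section Blocks

variable {R : Type*} [CommRing R] {z c z' c' : ℕ}

/-- All the entries of `M` outside the upper right block vanish. -/
def IsUpperRight (M : Matrix (Fin (z + c)) (Fin (z' + c')) R) : Prop :=
  (∀ i j, M (Fin.natAdd z i) j = 0) ∧ ∀ i j, M i (Fin.castAdd c' j) = 0

/-- The upper right block of `M`. -/
def upperRight (M : Matrix (Fin (z + c)) (Fin (z' + c')) R) : Matrix (Fin z) (Fin c') R :=
  M.submatrix (Fin.castAdd c) (Fin.natAdd z')

theorem IsUpperRight.mulVec {M : Matrix (Fin (z + c)) (Fin (z' + c')) R} (hM : IsUpperRight M)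
    (x : Fin (z' + c') → R) (i : Fin z) :
    M.mulVec x (Fin.castAdd c i) = (upperRight M).mulVec (fun j => x (Fin.natAdd z' j)) i := by
  simp [Matrix.mulVec, dotProduct, Fin.sum_univ_add, hM.2, upperRight]

theorem IsUpperRight.mulVec_natAdd {M : Matrix (Fin (z + c)) (Fin (z' + c')) R}
    (hM : IsUpperRight M) (x : Fin (z' + c') → R) (i : Fin c) :
    M.mulVec x (Fin.natAdd z i) = 0 := by
  simp [Matrix.mulVec, dotProduct, hM.1]

/-- M factors through its block by means of two 0-1 matrices, and the block is a submatrix of M. -/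
theorem IsUpperRight.rank [Nontrivial R] {M : Matrix (Fin (z + c)) (Fin (z' + c')) R}
    (hM : IsUpperRight M) : M.rank = (upperRight M).rank := by
  refine le_antisymm ?_ (Matrix.rank_submatrix_le _ _ _)
  have h : M = (1 : Matrix (Fin (z + c)) (Fin (z + c)) R).submatrix id (Fin.castAdd c) *
      (upperRight M *
        (1 : Matrix (Fin (z' + c')) (Fin (z' + c')) R).submatrix (Fin.natAdd z') id) := by
    ext i j
    simp only [Matrix.mul_apply, Matrix.submatrix_apply, Matrix.one_apply, id]
    refine Fin.addCases (fun i => ?_) (fun i => ?_) i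
    · rw [Finset.sum_eq_single i]
      · refine Fin.addCases (fun j => ?_) (fun j => ?_) j
        · rw [hM.2, Finset.sum_eq_zero, mul_zero]
          intro k _
          rw [if_neg, mul_zero]
          intro hk
          have := congrArg Fin.val hk
          simp at this
          omega
        · rw [Finset.sum_eq_single j]
          · simp [upperRight]
          · intro k _ hk
            rw [if_neg, mul_zero]
            simpa using hk
          · simp
      · intro k _ hk
        rw [if_neg, zero_mul]
        simpa using hk.symm
      · simp
    · rw [hM.1, Finset.sum_eq_zero]
      intro k _
      rw [if_neg, zero_mul]
      intro hk
      have := congrArg Fin.val hk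
      simp at this
      omega
  conv_lhs => rw [h]
  exact (Matrix.rank_mul_le_right _ _).trans (Matrix.rank_mul_le_left _ _)

theorem IsUpperRight.map {R' : Type*} [CommRing R'] (f : R →+* R')
    {M : Matrix (Fin (z + c)) (Fin (z' + c')) R} (hM : IsUpperRight M) :
    IsUpperRight (M.map f) :=
  ⟨fun i j => by rw [Matrix.map_apply, hM.1, map_zero],
    fun i j => by rw [Matrix.map_apply, hM.2, map_zero]⟩

theorem rank_eq_card_iff_det_ne_zero {F : Type*} [Field F] (N : Matrix (Fin z) (Fin z) F) :
    N.rank = z ↔ N.det ≠ 0 := by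
  refine ⟨fun h => ?_, fun h => by rw [Matrix.rank_of_det_ne_zero h, Fintype.card_fin]⟩
  rw [← isUnit_iff_ne_zero, ← Matrix.isUnit_iff_isUnit_det, ← Matrix.mulVec_surjective_iff_isUnit]
  have h1 : LinearMap.range N.mulVecLin = ⊤ := by
    apply Submodule.eq_top_of_finrank_eq
    rw [Module.finrank_fin_fun]
    exact h
  exact LinearMap.range_eq_top.1 h1

/-- Under any homomorphism to a field the rank equals the size of the square block exactly when the
image of its determinant is nonzero. Applied to the fraction field this gives the generic rank, and
applied at complex points it shows that this one minor controls the rank. -/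
theorem exists_controlling_minor (hz : c' = z)
    {M : Matrix (Fin (z + c)) (Fin (z' + c')) ℤ[T;T⁻¹]} (hM : IsUpperRight M)
    (hdet : ((upperRight M).submatrix id (Fin.cast hz.symm)).det ≠ 0) :
    ∃ F : Finset ((Fin (genericRank M) ↪o Fin (z + c)) × (Fin (genericRank M) ↪o Fin (z' + c'))),
      ControlsRank M F ∧
        ∀ p ∈ F, minor M p = ((upperRight M).submatrix id (Fin.cast hz.symm)).det := by
  subst hz
  simp only [Fin.cast_refl, Matrix.submatrix_id_id] at hdet ⊢
  have hrank : ∀ {F : Type} [Field F] (f : ℤ[T;T⁻¹] →+* F),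
      (M.map f).rank = c' ↔ f (upperRight M).det ≠ 0 := fun {F} _ f => by
    rw [(hM.map f).rank, rank_eq_card_iff_det_ne_zero, f.map_det]
    rfl
  have hr : genericRank M = c' := (hrank _).2 <| by
    rwa [Ne, map_eq_zero_iff _ (IsFractionRing.injective ℤ[T;T⁻¹] (FractionRing ℤ[T;T⁻¹]))]
  refine ⟨{((Fin.castOrderIso hr).toOrderEmbedding.trans (Fin.castAddOrderEmb c),
    (Fin.castOrderIso hr).toOrderEmbedding.trans (Fin.natAddOrderEmb z'))}, ?_⟩
  have hminor : minor M ((Fin.castOrderIso hr).toOrderEmbedding.trans (Fin.castAddOrderEmb c),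
      (Fin.castOrderIso hr).toOrderEmbedding.trans (Fin.natAddOrderEmb z')) =
      (upperRight M).det :=
    Matrix.det_submatrix_equiv_self (Fin.castOrderIso hr).toEquiv (upperRight M)
  refine ⟨fun x => ?_, fun p hp => by rw [Finset.mem_singleton.1 hp, hminor]⟩
  simp only [Finset.mem_singleton, exists_eq_left, hminor]
  rw [← hrank, hr]

end Blocks

end PathHomology
end

noncomputable section

/-! ### The formal differential in adapted bases -/

namespace PathHomology

theorem noWrap_of_lt {S : Finset ℕ} {n : ℕ} (h : 2 * S.sup id < n) : NoWrap S n := fun _ hs =>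
  lt_of_le_of_lt (Nat.mul_le_mul_left 2 (Finset.le_sup (f := id) hs)) h

namespace OmegaBasis

variable {S : Finset ℕ} (E : OmegaBasis S)

/-- The boundary matrices with a formal parameter. -/
def formalDifferential (k : ℕ) : Matrix (Fin (E.dim k)) (Fin (E.dim (k + 1))) ℚ[T;T⁻¹] :=
  E.differential k (LaurentPolynomial.T 1)

theorem map_formalDifferential {K : Type*} [Field K] [CharZero K] (ζ : Kˣ) (k : ℕ) :
    (E.formalDifferential k).map (ratEval ζ) = E.differential k (ζ : K) := by
  rw [formalDifferential, map_differential, ratEval_T]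

/-- The identity ∂² = 0 is available at n-th roots of unity for all large n, enough to force the
Laurent polynomial entries to vanish. -/
theorem formalDifferential_mul (h0 : 0 ∉ S) (k : ℕ) :
    E.formalDifferential k * E.formalDifferential (k + 1) = 0 := by
  refine Matrix.ext fun i j => ?_
  refine eq_zero_of_ratEval_roots_eq_zero (2 * S.sup id) fun n hn ζ hζ => ?_
  have h := E.differential_mul_differential_of_root h0 (noWrap_of_lt hn) (by omega) hζ k
  rw [← map_formalDifferential, ← map_formalDifferential, ← Matrix.map_mul] at h
  exact congrFun (congrFun h i) j

/-- The formal boundary matrix leaving degree `k`. -/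
def outgoing : (k : ℕ) → Matrix (Fin (E.dim (k - 1))) (Fin (E.dim k)) ℚ[T;T⁻¹]
  | 0 => 0
  | k + 1 => E.formalDifferential k

theorem outgoing_mul (h0 : 0 ∉ S) (k : ℕ) : E.outgoing k * E.formalDifferential k = 0 := by
  cases k with
  | zero => exact Matrix.zero_mul _
  | succ k => exact E.formalDifferential_mul h0 k

/-- Bases over the rational Laurent polynomials adapted to the kernels of the boundary maps. -/
structure Adapted where
  /-- the rank of the kernel -/
  z : ℕ → ℕ
  /-- the rank of a complement of the kernel -/
  c : ℕ → ℕ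
  /-- the basis vectors, those of the kernel first -/
  vectors : (k : ℕ) → Matrix (Fin (E.dim k)) (Fin (z k + c k)) ℚ[T;T⁻¹]
  /-- the coordinates -/
  coords : (k : ℕ) → Matrix (Fin (z k + c k)) (Fin (E.dim k)) ℚ[T;T⁻¹]
  vectors_mul_coords : ∀ k, vectors k * coords k = 1
  coords_mul_vectors : ∀ k, coords k * vectors k = 1
  outgoing_mulVec_eq_zero : ∀ k x,
    (E.outgoing k).mulVec x = 0 ↔ ∀ j, (coords k).mulVec x (Fin.natAdd (z k) j) = 0

theorem nonempty_adapted : Nonempty E.Adapted := by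
  choose z c G H h1 h2 h3 using fun k => exists_adapted_basis (E.outgoing k)
  exact ⟨⟨z, c, G, H, h1, h2, h3⟩⟩

namespace Adapted

variable {E} (A : E.Adapted)

/-- The boundary matrices in the adapted bases. -/
def symbol (k : ℕ) : Matrix (Fin (A.z k + A.c k)) (Fin (A.z (k + 1) + A.c (k + 1))) ℚ[T;T⁻¹] :=
  A.coords k * E.formalDifferential k * A.vectors (k + 1)

theorem coords_vectors_mulVec (k : ℕ) (x : Fin (A.z k + A.c k) → ℚ[T;T⁻¹]) :
    (A.coords k).mulVec ((A.vectors k).mulVec x) = x := by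
  rw [Matrix.mulVec_mulVec, A.coords_mul_vectors, Matrix.one_mulVec]

theorem vectors_mul_symbol (k : ℕ) :
    A.vectors k * A.symbol k = E.formalDifferential k * A.vectors (k + 1) := by
  rw [symbol, ← Matrix.mul_assoc, ← Matrix.mul_assoc, A.vectors_mul_coords, Matrix.one_mul]

theorem outgoing_mul_vectors (k : ℕ) (j : Fin (A.z k)) :
    (E.outgoing k * A.vectors k).col (Fin.castAdd (A.c k) j) = 0 := by
  rw [← Matrix.mulVec_single_one, ← Matrix.mulVec_mulVec, A.outgoing_mulVec_eq_zero]
  intro i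
  rw [A.coords_vectors_mulVec, Pi.single_apply, if_neg]
  intro h
  have := congrArg Fin.val h
  simp at this
  omega

/-- Boundaries are cycles, so the rows of the complement vanish; the columns of cycle basis vectors
vanish because the differential kills them. -/
theorem isUpperRight_symbol (h0 : 0 ∉ S) (k : ℕ) : IsUpperRight (A.symbol k) := by
  refine ⟨fun i j => ?_, fun i j => ?_⟩
  · have h : (E.outgoing k).mulVec
        ((E.formalDifferential k * A.vectors (k + 1)).mulVec (Pi.single j 1)) = 0 := by
      rw [Matrix.mulVec_mulVec, ← Matrix.mul_assoc, E.outgoing_mul h0, Matrix.zero_mul,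
        Matrix.zero_mulVec]
    have h1 := (A.outgoing_mulVec_eq_zero k _).1 h i
    rw [Matrix.mulVec_mulVec, ← Matrix.mul_assoc, Matrix.mulVec_single_one] at h1
    exact h1
  · have h := A.outgoing_mul_vectors (k + 1) j
    have h1 : (A.symbol k).col (Fin.castAdd _ j) = 0 := by
      rw [← Matrix.mulVec_single_one, symbol, Matrix.mul_assoc, ← Matrix.mulVec_mulVec,
        Matrix.mulVec_single_one]
      exact (congrArg _ h).trans (Matrix.mulVec_zero _)
    exact congrFun h1 i

/-- A combination of complement vectors that the differential kills is a cycle, so its complement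
coordinates vanish. -/
theorem upperRight_symbol_injective (h0 : 0 ∉ S) (k : ℕ) :
    Function.Injective (upperRight (A.symbol k)).mulVecLin := by
  rw [← LinearMap.ker_eq_bot, LinearMap.ker_eq_bot']
  intro y hy
  have hM := A.isUpperRight_symbol h0 k
  let x : Fin (A.z (k + 1) + A.c (k + 1)) → ℚ[T;T⁻¹] := Fin.append 0 y
  have hx : (A.symbol k).mulVec x = 0 := by
    funext i
    refine Fin.addCases (fun i => ?_) (fun i => ?_) i
    · rw [hM.mulVec]
      simpa [x] using congrFun hy i
    · exact hM.mulVec_natAdd x i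
  have h1 : (E.outgoing (k + 1)).mulVec ((A.vectors (k + 1)).mulVec x) = 0 := by
    change (E.formalDifferential k).mulVec _ = 0
    rw [Matrix.mulVec_mulVec, ← A.vectors_mul_symbol, ← Matrix.mulVec_mulVec, hx,
      Matrix.mulVec_zero]
  funext j
  have h2 := (A.outgoing_mulVec_eq_zero _ _).1 h1 j
  rw [A.coords_vectors_mulVec] at h2
  simpa [x] using h2

variable {K : Type*} [Field K] [CharZero K] {n : ℕ} {ζ : Kˣ}

/-- Formal cycles specialize to cycles of the ζ-block, which are boundaries since the block is
acyclic. The cycle coordinates of the vector they bound are irrelevant, because the corresponding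
columns are zero. -/
theorem upperRight_symbol_surjective (h0 : 0 ∉ S) (h1 : 1 ∈ S) (hn : NoWrap S n) (hn0 : n ≠ 0)
    (hζ : ζ ^ n = 1) (hζ1 : ζ ≠ 1) (k : ℕ) :
    Function.Surjective ((upperRight (A.symbol k)).map (ratEval ζ)).mulVec := by
  intro v
  let x : Fin (A.z k + A.c k) → K := Fin.append v 0
  have hcyc : ((A.vectors k).map (ratEval ζ)).mulVec x ∈
      coordCycles (fun k => E.differential k (ζ : K)) k := by
    have h2 : ((E.outgoing k).map (ratEval ζ)).mulVec
        (((A.vectors k).map (ratEval ζ)).mulVec x) = 0 := by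
      rw [Matrix.mulVec_mulVec, ← Matrix.map_mul]
      funext i
      simp only [Matrix.mulVec, dotProduct, Fin.sum_univ_add, x, Fin.append_left,
        Fin.append_right, Pi.zero_apply, mul_zero, Finset.sum_const_zero, add_zero,
        Matrix.map_apply]
      refine Finset.sum_eq_zero fun j _ => ?_
      have h3 := congrFun (A.outgoing_mul_vectors k j) i
      rw [Matrix.col_apply] at h3
      rw [h3, Pi.zero_apply, map_zero, zero_mul]
    cases k with
    | zero => trivial
    | succ k =>
      rw [outgoing, E.map_formalDifferential] at h2
      exact h2
  obtain ⟨y, hy⟩ := E.exists_differential_mulVec_eq h0 hn hn0 hζ h1 hζ1 k _ hcyc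
  have hM := (A.isUpperRight_symbol h0 k).map (ratEval ζ)
  refine ⟨fun j => ((A.coords (k + 1)).map (ratEval ζ)).mulVec y (Fin.natAdd _ j), ?_⟩
  have h4 : ((A.symbol k).map (ratEval ζ)).mulVec
      (((A.coords (k + 1)).map (ratEval ζ)).mulVec y) = x := by
    rw [Matrix.mulVec_mulVec, ← Matrix.map_mul, symbol, Matrix.mul_assoc, A.vectors_mul_coords,
      Matrix.mul_one, Matrix.map_mul, ← Matrix.mulVec_mulVec, E.map_formalDifferential, hy,
      Matrix.mulVec_mulVec, ← Matrix.map_mul, A.coords_mul_vectors,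
      Matrix.map_one _ (map_zero _) (map_one _), Matrix.one_mulVec]
  funext i
  have h5 := congrFun h4 (Fin.castAdd _ i)
  rw [hM.mulVec] at h5
  refine h5.trans ?_
  simp [x]

/-- The block is square: injectivity over ℚ[t,t⁻¹] gives one inequality, surjectivity at the single
root ζ = −1, with n even and large, the other. -/
theorem c_succ (h0 : 0 ∉ S) (h1 : 1 ∈ S) (k : ℕ) : A.c (k + 1) = A.z k := by
  refine le_antisymm ?_ ?_
  · simpa using LinearMap.finrank_le_finrank_of_injective (A.upperRight_symbol_injective h0 k)
  · have hn : NoWrap S (2 * (S.sup id + 1)) := noWrap_of_lt (by omega)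
    have hne : (-1 : ℂˣ) ≠ 1 := fun h => by
      have := congrArg Units.val h
      norm_num at this
    have h := A.upperRight_symbol_surjective (ζ := (-1 : ℂˣ)) h0 h1 hn (by omega)
      (by rw [pow_mul]; simp) hne k
    simpa using LinearMap.finrank_le_finrank_of_surjective
      (f := ((upperRight (A.symbol k)).map (ratEval (-1 : ℂˣ))).mulVecLin) h

/-- The adapted bases can be rescaled to integral ones. -/
theorem exists_integral : ∃ (a : ℕ → ℤ)
    (coeff : (k : ℕ) → Fin (A.z k + A.c k) → (Fin k → S) → ℤ[T;T⁻¹])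
    (sym : (k : ℕ) →
      Matrix (Fin (A.z k + A.c k)) (Fin (A.z (k + 1) + A.c (k + 1))) ℤ[T;T⁻¹]),
    (∀ k, a k ≠ 0) ∧
    (∀ k i w, intToRat (coeff k i w) =
      a k * ((E.basis k).map (algebraMap ℚ ℚ[T;T⁻¹]) * A.vectors k) w i) ∧
    ∀ k i j, (a k : ℚ[T;T⁻¹]) * intToRat (sym k i j) = a (k + 1) * A.symbol k i j := by
  choose e he q hq using fun k =>
    exists_intToRat_eq_mul fun p : Fin (A.z k + A.c k) × (Fin k → S) =>
      ((E.basis k).map (algebraMap ℚ ℚ[T;T⁻¹]) * A.vectors k) p.2 p.1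
  choose e' he' q' hq' using fun k =>
    exists_intToRat_eq_mul fun p : Fin (A.z k + A.c k) × Fin (A.z (k + 1) + A.c (k + 1)) =>
      A.symbol k p.1 p.2
  -- Rescaling the bases multiplies the symbol by a (k + 1) / a k, which is e' k * e (k + 1) for
  -- this choice; e' k clears the denominators of the symbol, while the factor e k of a k clears
  -- those of the basis vectors.
  refine ⟨fun k => (∏ i ∈ Finset.range k, e' i) * ∏ i ∈ Finset.range (k + 1), e i,
    fun k i w => ((∏ i ∈ Finset.range k, e' i) * ∏ i ∈ Finset.range k, e i : ℤ) * q k (i, w),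
    fun k => Matrix.of fun i j => (e (k + 1) : ℤ[T;T⁻¹]) * q' k (i, j), fun k => ?_,
    fun k i w => ?_, fun k i j => ?_⟩
  · exact mul_ne_zero (Finset.prod_ne_zero_iff.2 fun i _ => he' i)
      (Finset.prod_ne_zero_iff.2 fun i _ => he i)
  · beta_reduce
    rw [map_mul, map_intCast, hq, Finset.prod_range_succ e]
    push_cast
    ring
  · beta_reduce
    rw [Matrix.of_apply, map_mul, map_intCast, hq', Finset.prod_range_succ e (k + 1),
      Finset.prod_range_succ e' k]
    push_cast
    ring

end Adapted

end OmegaBasis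

end PathHomology
end

noncomputable section

/-! ### Integral symbol data with empty cyclotomic support -/

namespace PathHomology

namespace OmegaBasis.Adapted

variable {S : Finset ℕ} {E : OmegaBasis S} (A : E.Adapted) {a : ℕ → ℤ}
  {coeff : (k : ℕ) → Fin (A.z k + A.c k) → (Fin k → S) → ℤ[T;T⁻¹]}
  {sym : (k : ℕ) → Matrix (Fin (A.z k + A.c k)) (Fin (A.z (k + 1) + A.c (k + 1))) ℤ[T;T⁻¹]}
  (ha : ∀ k, a k ≠ 0)
  (hcoeff : ∀ k i w, intToRat (coeff k i w) =
    a k * ((E.basis k).map (algebraMap ℚ ℚ[T;T⁻¹]) * A.vectors k) w i)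
  (hsym : ∀ k i j, (a k : ℚ[T;T⁻¹]) * intToRat (sym k i j) = a (k + 1) * A.symbol k i j)
  {K : Type*} [Field K] [CharZero K] {n : ℕ} {ζ : Kˣ}

include hcoeff in
-- Up to the nonzero integer a k and the invertible change to the adapted basis, the integral
-- vectors give the parametrization of the block, so its properties carry over to them.
theorem sum_fourierVec (k : ℕ) (x : Fin (A.z k + A.c k) → K) :
    ∑ i, x i • fourierVec n ζ (coeff k i) =
      (a k : K) • E.param n ζ k (((A.vectors k).map (ratEval ζ)).mulVec x) := by
  have hW : ⇑(ratEval ζ) ∘ ⇑(algebraMap ℚ ℚ[T;T⁻¹]) = algebraMap ℚ K :=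
    congrArg DFunLike.coe (Subsingleton.elim ((ratEval ζ).comp (algebraMap ℚ _)) (algebraMap ℚ K))
  have h1 : ∀ i, fourierVec n ζ (coeff k i) =
      fourierMap n S ζ k fun w => evalAt ζ (coeff k i w) := fun i => by
    simp [fourierVec, fourierMap, Fintype.linearCombination_apply]
  simp only [h1, ← map_smul, ← map_sum, E.param_apply]
  congr 1
  rw [Matrix.mulVec_mulVec, ← Matrix.mulVec_smul, ← hW, ← Matrix.map_map, ← Matrix.map_mul]
  funext w
  simp only [Finset.sum_apply, Pi.smul_apply, smul_eq_mul, ← ratEval_intToRat, hcoeff, map_mul,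
    map_intCast, Matrix.mulVec, dotProduct, Matrix.map_apply]
  exact Finset.sum_congr rfl fun i _ => by ring

theorem coords_vectors_mulVec_eval (k : ℕ) (x : Fin (A.z k + A.c k) → K) :
    ((A.coords k).map (ratEval ζ)).mulVec (((A.vectors k).map (ratEval ζ)).mulVec x) = x := by
  rw [Matrix.mulVec_mulVec, ← Matrix.map_mul, A.coords_mul_vectors,
    Matrix.map_one _ (map_zero _) (map_one _), Matrix.one_mulVec]

theorem vectors_coords_mulVec_eval (k : ℕ) (x : Fin (E.dim k) → K) :
    ((A.vectors k).map (ratEval ζ)).mulVec (((A.coords k).map (ratEval ζ)).mulVec x) = x := by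
  rw [Matrix.mulVec_mulVec, ← Matrix.map_mul, A.vectors_mul_coords,
    Matrix.map_one _ (map_zero _) (map_one _), Matrix.one_mulVec]

include ha hcoeff in
theorem linearIndependent_fourierVec (h0 : 0 ∉ S) (hn : NoWrap S n) (hn0 : n ≠ 0) (k : ℕ) :
    LinearIndependent K fun i => fourierVec n ζ (coeff k i) := by
  rw [linearIndependent_iff_injective_fintypeLinearCombination]
  intro x y h
  simp only [Fintype.linearCombination_apply, A.sum_fourierVec hcoeff] at h
  have h1 := E.param_injective h0 hn hn0 k
    (smul_right_injective _ (Int.cast_ne_zero.2 (ha k) : (a k : K) ≠ 0) h)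
  rw [← A.coords_vectors_mulVec_eval (ζ := ζ) k x, h1, A.coords_vectors_mulVec_eval]

include ha hcoeff in
theorem span_fourierVec (h0 : 0 ∉ S) (hn : NoWrap S n) (hn0 : n ≠ 0) (hζ : ζ ^ n = 1) (k : ℕ) :
    Submodule.span K (Set.range fun i => fourierVec n ζ (coeff k i)) = OmegaMode n S ζ k := by
  rw [← Fintype.range_linearCombination, ← E.range_param h0 hn hn0 hζ]
  refine le_antisymm ?_ ?_
  · rintro _ ⟨x, rfl⟩
    rw [Fintype.linearCombination_apply, A.sum_fourierVec hcoeff]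
    exact Submodule.smul_mem _ _ (LinearMap.mem_range_self _ _)
  · rintro _ ⟨x, rfl⟩
    refine ⟨(a k : K)⁻¹ • ((A.coords k).map (ratEval ζ)).mulVec x, ?_⟩
    rw [Fintype.linearCombination_apply, A.sum_fourierVec hcoeff, Matrix.mulVec_smul,
      A.vectors_coords_mulVec_eval, map_smul, smul_inv_smul₀ (Int.cast_ne_zero.2 (ha k))]

include hsym in
theorem evalAt_sym (k : ℕ) (i j) : (a k : K) * evalAt ζ (sym k i j) =
    a (k + 1) * ratEval ζ (A.symbol k i j) := by
  have h := congrArg (ratEval ζ) (hsym k i j)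
  rwa [map_mul, map_mul, map_intCast, map_intCast, ratEval_intToRat] at h

include hcoeff hsym in
theorem boundary_fourierVec (h0 : 0 ∉ S) (hn : NoWrap S n) (hn0 : n ≠ 0) (hζ : ζ ^ n = 1) (k : ℕ)
    (j : Fin (A.z (k + 1) + A.c (k + 1))) :
    boundary K (ZMod n) k (fourierVec n ζ (coeff (k + 1) j)) =
      ∑ i, evalAt ζ (sym k i j) • fourierVec n ζ (coeff k i) := by
  have h1 : fourierVec n ζ (coeff (k + 1) j) = (a (k + 1) : K) •
      E.param n ζ (k + 1) (((A.vectors (k + 1)).map (ratEval ζ)).mulVec (Pi.single j 1)) := by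
    rw [← A.sum_fourierVec hcoeff, Finset.sum_eq_single j]
    · simp
    · intro i _ hi
      simp [hi]
    · simp
  have h2 : (a k : K) • (fun i => evalAt ζ (sym k i j)) =
      (a (k + 1) : K) • ((A.symbol k).map (ratEval ζ)).mulVec (Pi.single j 1) := by
    funext i
    rw [Matrix.mulVec_single_one]
    exact A.evalAt_sym hsym k i j
  rw [h1, map_smul, E.boundary_param h0 hn hn0 hζ, A.sum_fourierVec hcoeff, ← map_smul,
    ← map_smul, ← Matrix.mulVec_smul _ (a k : K), h2, Matrix.mulVec_smul, Matrix.mulVec_mulVec,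
    Matrix.mulVec_mulVec, ← Matrix.map_mul, A.vectors_mul_symbol, Matrix.map_mul,
    E.map_formalDifferential]

include ha hsym in
theorem evalAt_det_ne_zero (h0 : 0 ∉ S) (h1 : 1 ∈ S) (hn : NoWrap S n) (hn0 : n ≠ 0)
    (hζ : ζ ^ n = 1) (hζ1 : ζ ≠ 1) (k : ℕ) :
    evalAt ζ ((upperRight (sym k)).submatrix id (Fin.cast (A.c_succ h0 h1 k).symm)).det ≠ 0 := by
  rw [RingHom.map_det, ← isUnit_iff_ne_zero, ← Matrix.isUnit_iff_isUnit_det,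
    ← Matrix.mulVec_surjective_iff_isUnit]
  intro v
  have hk : (a k : K) ≠ 0 := Int.cast_ne_zero.2 (ha k)
  have hk' : (a (k + 1) : K) ≠ 0 := Int.cast_ne_zero.2 (ha (k + 1))
  -- The integral symbol is a (k + 1) / a k times the rational one; the target v is rescaled by the
  -- inverse ratio.
  obtain ⟨y, hy⟩ := A.upperRight_symbol_surjective h0 h1 hn hn0 hζ hζ1 k
    (((a k : K) * (a (k + 1) : K)⁻¹) • v)
  refine ⟨fun i => y (Fin.cast (A.c_succ h0 h1 k).symm i), funext fun i => ?_⟩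
  have h2 := congrFun hy i
  simp only [Matrix.mulVec, dotProduct, Pi.smul_apply, smul_eq_mul] at h2 ⊢
  have h3 := Equiv.sum_comp (finCongr (A.c_succ h0 h1 k).symm)
    fun j => (upperRight (sym k)).map (evalAt ζ) i j * y j
  refine h3.trans (mul_left_cancel₀ hk ?_)
  have h4 : (a k : K) * v i = a (k + 1) * ((a k : K) * (a (k + 1) : K)⁻¹ * v i) := by
    field_simp
  rw [h4, ← h2, Finset.mul_sum, Finset.mul_sum]
  refine Finset.sum_congr rfl fun j _ => ?_
  rw [← mul_assoc, ← mul_assoc]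
  congr 1
  exact A.evalAt_sym hsym k _ _

include ha hsym in
theorem isUpperRight_sym (h0 : 0 ∉ S) (k : ℕ) : IsUpperRight (sym k) := by
  have h : ∀ i j, A.symbol k i j = 0 → sym k i j = 0 := fun i j hij => by
    have h1 := hsym k i j
    rw [hij, mul_zero] at h1
    have hk : (a k : ℚ[T;T⁻¹]) ≠ 0 := by
      rw [← map_intCast (algebraMap ℚ ℚ[T;T⁻¹])]
      exact (map_ne_zero_iff _ (algebraMap ℚ ℚ[T;T⁻¹]).injective).2 (Int.cast_ne_zero.2 (ha k))
    exact intToRat_injective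
      (((mul_eq_zero.1 h1).resolve_left hk).trans (map_zero intToRat).symm)
  have hM := A.isUpperRight_symbol h0 k
  exact ⟨fun i j => h _ _ (hM.1 i j), fun i j => h _ _ (hM.2 i j)⟩

end OmegaBasis.Adapted

/-- There are symbol data whose cyclotomic support set is empty. -/
theorem exists_symbolData_cyclotomicSupport_eq_empty {S : Finset ℕ} (h1 : 1 ∈ S) (h0 : 0 ∉ S) :
    ∃ D : SymbolData.{u} S, D.cyclotomicSupport = ∅ := by
  have hpos : ∀ {n}, NoWrap S n → n ≠ 0 := fun {n} hn => by
    have := hn 1 h1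
    omega
  obtain ⟨E⟩ := nonempty_omegaBasis S
  obtain ⟨A⟩ := E.nonempty_adapted
  obtain ⟨a, coeff, sym, ha, hcoeff, hsym⟩ := A.exists_integral
  have hdet : ∀ k q, 2 ≤ q → ∀ ζ : ℂˣ, IsPrimitiveRoot ζ q → evalAt ζ
      ((upperRight (sym k)).submatrix id (Fin.cast (A.c_succ h0 h1 k).symm)).det ≠ 0 := by
    intro k q hq ζ hζ
    -- Every q ≥ 2 has an admissible multiple n, so each primitive q-th root of unity occurs as a
    -- nontrivial mode.
    have hn : NoWrap S (q * (2 * S.sup id + 1)) :=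
      noWrap_of_lt (Nat.lt_of_lt_of_le (Nat.lt_succ_self _) (Nat.le_mul_of_pos_left _ (by omega)))
    exact A.evalAt_det_ne_zero ha hsym h0 h1 hn (hpos hn)
      (by rw [pow_mul, hζ.pow_eq_one, one_pow]) (hζ.ne_one (by omega)) k
  have hroot : ∀ q, q ≠ 0 → ∃ ζ : ℂˣ, IsPrimitiveRoot ζ q := fun q hq => by
    have h := Complex.isPrimitiveRoot_exp q hq
    exact ⟨(h.isUnit hq).unit, h.isUnit_unit hq⟩
  choose F hF hF' using fun k => exists_controlling_minor (A.c_succ h0 h1 k)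
    -- Nonvanishing at ζ = −1 already shows that the determinant is not the zero Laurent polynomial.
    (A.isUpperRight_sym ha hsym h0 k) fun h => by
      obtain ⟨ζ, hζ⟩ := hroot 2 (by norm_num)
      exact hdet k 2 le_rfl ζ hζ (by rw [h, map_zero])
  refine ⟨{
    dim := fun k => A.z k + A.c k
    coeff := coeff
    symbol := sym
    minors := F
    linearIndependent := fun K _ _ n hn ζ _ k =>
      A.linearIndependent_fourierVec ha hcoeff h0 hn (hpos hn) k
    span_eq := fun K _ _ n hn ζ hζ k => A.span_fourierVec ha hcoeff h0 hn (hpos hn) hζ k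
    boundary_eq := fun K _ _ n hn ζ hζ k j =>
      A.boundary_fourierVec hcoeff hsym h0 hn (hpos hn) hζ k j
    controls := hF }, ?_⟩
  rw [Set.eq_empty_iff_forall_notMem]
  rintro q ⟨hq, k, p, hp, hdvd⟩
  obtain ⟨ζ, hζ⟩ := hroot q (by omega)
  -- If Φ_q divided the chosen minor, that minor would vanish at a primitive q-th root of unity.
  refine hdet k q hq ζ hζ ?_
  rw [← hF' k p hp]
  have h2 := map_dvd (evalAt ζ) hdvd
  have h3 : evalAt ζ (Polynomial.toLaurent (Polynomial.cyclotomic q ℤ)) = 0 := by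
    rw [evalAt, LaurentPolynomial.eval₂_toLaurent, ← Polynomial.eval_map,
      Polynomial.map_cyclotomic]
    exact (IsPrimitiveRoot.coe_units_iff.2 hζ).isRoot_cyclotomic (by omega)
  rw [h3] at h2
  exact zero_dvd_iff.1 h2

end PathHomology
end

theorem mainTheorem6 (S : Finset ℕ) (h1 : 1 ∈ S) (h0 : 0 ∉ S) :
    (∃ D : PathHomology.SymbolData.{u} S, D.cyclotomicSupport.Finite) ∧
    ∀ D : PathHomology.SymbolData.{u} S, ∀ (K : Type u) [Field K] [CharZero K],
      (∀ n : ℕ, PathHomology.NoWrap S n → ∀ ζ : Kˣ, ζ ^ n = 1 → ζ ≠ 1 →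
        orderOf ζ ∉ D.cyclotomicSupport →
          ∀ m : ℕ, Subsingleton (PathHomology.ModeHomology n S ζ m)) ∧
      (∀ n n' : ℕ, PathHomology.NoWrap S n → PathHomology.NoWrap S n' →
        (∀ q ∈ D.cyclotomicSupport, q ∣ n ↔ q ∣ n') →
          ∀ m : ℕ, PathHomology.betti K n S m = PathHomology.betti K n' S m) ∧
      (∀ p p' : ℕ, p.Prime → p'.Prime → PathHomology.NoWrap S p → PathHomology.NoWrap S p' →
        p ∉ D.cyclotomicSupport → p' ∉ D.cyclotomicSupport →
          ∀ m : ℕ, PathHomology.betti K p S m = PathHomology.betti K p' S m) := by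
  have hbetti : ∀ (D : PathHomology.SymbolData.{u} S) (K : Type u) [Field K] [CharZero K]
      (n n' : ℕ), PathHomology.NoWrap S n → PathHomology.NoWrap S n' → ∀ m : ℕ,
        PathHomology.betti K n S m = PathHomology.betti K n' S m := fun D K _ _ n n' hn hn' m => by
    rw [PathHomology.betti_eq_finrank_coordHomology D h1 hn,
      PathHomology.betti_eq_finrank_coordHomology D h1 hn']
  refine ⟨?_, fun D K _ _ => ⟨fun n _ ζ _ hζ _ m => PathHomology.subsingleton_modeHomology h1 hζ m,
    fun n n' hn hn' _ => hbetti D K n n' hn hn',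
    fun p p' _ _ hp hp' _ _ => hbetti D K p p' hp hp'⟩⟩
  obtain ⟨D, hD⟩ := PathHomology.exists_symbolData_cyclotomicSupport_eq_empty.{u} h1 h0
  exact ⟨D, hD ▸ Set.finite_empty⟩
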